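/- Let $n$ be the number of items and $m$ the number of agents. Agent $i\in\{1,\dots,m\}$ is single-minded: she wants a nonempty set $S_i$ of items and has a rational valuation $v_i\ge 0$, so that her valuation function is $v_i(S)=v_i$ if $S_i\subseteq S$, and $v_i(S)=0$ otherwise. The supply is unlimited. An allocation/pricing $(a,p)$ consists of a set $a_i$ of items for each agent $i$ (agent $i$ loses if $a_i=\emptyset$ and wins otherwise) and a price $p(S)\ge 0$ for each set $S$ of items. Let $z_i=\max_S (v_i(S)-p(S))$, the maximum over all sets of items. The pair $(a,p)$ is envy free if for every agent $i$: if $z_i>0$ then $v_i(a_i)-p(a_i)=z_i$; if $z_i=0$ then $v_i(a_i)-p(a_i)=z_i$ or $a_i=\emptyset$; if $z_i<0$ then $a_i=\emptyset$. Its revenue is $\sum_{i:\,a_i\neq\emptyset}p(a_i)$. There is an algorithm that, given $n$, $m$, the indicator vectors of the sets $S_1,\dots,S_m$ and the valuations $v_1,\dots,v_m$ (fractions in lowest terms, in binary), computes in time polynomial in the bit length of this input an envy-free allocation/pricing $(a,p)$ whose revenue is maximal among all envy-free allocations/pricings (with arbitrary real prices $p(S)\ge 0$). Here $a_i\in\{\emptyset,S_i\}$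 for every $i$, and the pricing is output in a concise form: $p(\emptyset)=0$, the price $p(S_i)$ for each agent $i$ is listed, and all other nonempty sets have one common price, which is also listed; all these prices are rational. -/

import Mathlib

/-! ## Random access machines with logarithmic cost

A program works on finitely many variables and finitely many unbounded one-dimensional arrays, all
holding natural numbers. Every elementary operation is charged one unit plus the number of bits of
the numbers that it handles (logarithmic cost criterion), so that polynomial time on this machine
is the same as polynomial time on a Turing machine. -/

namespace RAM

/-- The elementary operations. Subtraction is truncated; `eq` and `lt` return `1` (true) or
`0` (false). -/
inductive Op where
  | add | sub | mul | div | mod | eq | lt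

/-- The result of an elementary operation. -/
def Op.apply : Op → ℕ → ℕ → ℕ
  | .add, a, b => a + b
  | .sub, a, b => a - b
  | .mul, a, b => a * b
  | .div, a, b => a / b
  | .mod, a, b => a % b
  | .eq, a, b => if a = b then 1 else 0
  | .lt, a, b => if a < b then 1 else 0

/-- Expressions: constants, variables, array cells (`cell r i` is the entry of the array `r` at the
index `i`) and elementary operations. -/
inductive Exp where
  | const (k : ℕ)
  | var (x : ℕ)
  | cell (r : ℕ) (i : Exp)
  | op (o : Op) (e₁ e₂ : Exp)

/-- Programs. A test succeeds when the value of its expression is not `0`. -/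
inductive Prog where
  | skip
  | assign (x : ℕ) (e : Exp)
  | store (r : ℕ) (i e : Exp)
  | seq (c d : Prog)
  | ite (e : Exp) (c d : Prog)
  | loop (e : Exp) (c : Prog)

/-- The contents of the memory: `var x` is the value of the variable `x`, and `cell r k` is the
entry of the array `r` at the index `k`. -/
structure State where
  var : ℕ → ℕ
  cell : ℕ → ℕ → ℕ

/-- Overwrite a variable. -/
def State.setVar (s : State) (x v : ℕ) : State :=
  { s with var := Function.update s.var x v }

/-- Overwrite an array cell. -/
def State.setCell (s : State) (r k v : ℕ) : State :=
  { s with cell := Function.update s.cell r (Function.update (s.cell r) k v) }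

/-- The value of an expression. -/
def Exp.value (s : State) : Exp → ℕ
  | .const k => k
  | .var x => s.var x
  | .cell r i => s.cell r (i.value s)
  | .op o e₁ e₂ => o.apply (e₁.value s) (e₂.value s)

/-- The cost of evaluating an expression: every constant, variable access, array access and
operation costs one unit plus the bit lengths of the numbers involved
(`Nat.size` is the number of binary digits). -/
def Exp.cost (s : State) : Exp → ℕ
  | .const k => 1 + k.size
  | .var x => 1 + (s.var x).size
  | .cell r i => i.cost s + (1 + (i.value s).size + (s.cell r (i.value s)).size)
  | .op _ e₁ e₂ => e₁.cost s + e₂.cost s + (1 + (e₁.value s).size + (e₂.value s).size)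

/-- `Exec c s t s'`: the program `c`, started in the state `s`, halts in the state `s'` after a
computation of total cost `t`. -/
inductive Exec : Prog → State → ℕ → State → Prop
  | skip (s : State) : Exec .skip s 1 s
  | assign (x : ℕ) (e : Exp) (s : State) :
      Exec (.assign x e) s (e.cost s + 1) (s.setVar x (e.value s))
  | store (r : ℕ) (i e : Exp) (s : State) :
      Exec (.store r i e) s (i.cost s + e.cost s + 1) (s.setCell r (i.value s) (e.value s))
  | seq {c d : Prog} {s s₁ s₂ : State} {t₁ t₂ : ℕ}
      (h₁ : Exec c s t₁ s₁) (h₂ : Exec d s₁ t₂ s₂) : Exec (.seq c d) s (t₁ + t₂) s₂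
  | ite_true {e : Exp} {c d : Prog} {s s₁ : State} {t : ℕ}
      (he : e.value s ≠ 0) (h : Exec c s t s₁) : Exec (.ite e c d) s (e.cost s + 1 + t) s₁
  | ite_false {e : Exp} {c d : Prog} {s s₁ : State} {t : ℕ}
      (he : e.value s = 0) (h : Exec d s t s₁) : Exec (.ite e c d) s (e.cost s + 1 + t) s₁
  | loop_done {e : Exp} {c : Prog} {s : State}
      (he : e.value s = 0) : Exec (.loop e c) s (e.cost s + 1) s
  | loop_step {e : Exp} {c : Prog} {s s₁ s₂ : State} {t₁ t₂ : ℕ}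
      (he : e.value s ≠ 0) (h₁ : Exec c s t₁ s₁) (h₂ : Exec (.loop e c) s₁ t₂ s₂) :
      Exec (.loop e c) s (e.cost s + 1 + t₁ + t₂) s₂

/-- Programs are deterministic: the cost and the final state are determined by the start. -/
theorem Exec.det {c : Prog} {s : State} {t : ℕ} {s' : State} (h : Exec c s t s') :
    ∀ {u : ℕ} {s'' : State}, Exec c s u s'' → t = u ∧ s' = s'' := by
  induction h with
  | skip s => intro u s'' k; cases k; exact ⟨rfl, rfl⟩
  | assign x e s => intro u s'' k; cases k; exact ⟨rfl, rfl⟩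
  | store r i e s => intro u s'' k; cases k; exact ⟨rfl, rfl⟩
  | seq h₁ h₂ ih₁ ih₂ =>
    intro u s'' k
    cases k with
    | seq k₁ k₂ =>
      obtain ⟨rfl, rfl⟩ := ih₁ k₁
      obtain ⟨rfl, rfl⟩ := ih₂ k₂
      exact ⟨rfl, rfl⟩
  | ite_true he h ih =>
    intro u s'' k
    cases k with
    | ite_true _ k => obtain ⟨rfl, rfl⟩ := ih k; exact ⟨rfl, rfl⟩
    | ite_false ke _ => exact absurd ke he
  | ite_false he h ih =>
    intro u s'' k
    cases k with
    | ite_true ke _ => exact absurd he ke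
    | ite_false _ k => obtain ⟨rfl, rfl⟩ := ih k; exact ⟨rfl, rfl⟩
  | loop_done he =>
    intro u s'' k
    cases k with
    | loop_done _ => exact ⟨rfl, rfl⟩
    | loop_step ke _ _ => exact absurd he ke
  | loop_step he h₁ h₂ ih₁ ih₂ =>
    intro u s'' k
    cases k with
    | loop_done ke => exact absurd ke he
    | loop_step _ k₁ k₂ =>
      obtain ⟨rfl, rfl⟩ := ih₁ k₁
      obtain ⟨rfl, rfl⟩ := ih₂ k₂
      exact ⟨rfl, rfl⟩

/-- The start of a computation on the input `l`: the variable `0` holds the length of `l`, the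
array `0` holds its entries, and everything else is `0`. -/
def State.input (l : List ℕ) : State where
  var x := if x = 0 then l.length else 0
  cell r k := if r = 0 then l.getD k 0 else 0

/-- The state holds the output `l`: the variable `1` holds the length of `l`, and the array `1`
starts with its entries. -/
def State.HasOutput (s : State) (l : List ℕ) : Prop :=
  s.var 1 = l.length ∧ ∀ (k : ℕ) (hk : k < l.length), s.cell 1 k = l[k]

/-- The size of an input: the number of bits of its entries, plus one for each entry. -/
def bitSize (l : List ℕ) : ℕ := (l.map fun a => a.size + 1).sum

/-- The search problem "given `x`, find some `y` with `R x y`" can be solved in polynomial time,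
when the inputs and the outputs are written as lists of natural numbers by `encIn` and `encOut`. -/
def SolvableInPolyTime {α : Type} {β : α → Type} (encIn : α → List ℕ)
    (encOut : (x : α) → β x → List ℕ) (R : (x : α) → β x → Prop) : Prop :=
  ∃ (c : Prog) (P : Polynomial ℕ), ∀ x : α, ∃ (t : ℕ) (s : State) (y : β x),
    Exec c (State.input (encIn x)) t s ∧ t ≤ P.eval (bitSize (encIn x)) ∧
      s.HasOutput (encOut x y) ∧ R x y

end RAM

/-! ## Envy-free allocations and pricings

The items are the elements of `Fin n`, the agents are the elements of `Fin m`, and `v i S` is the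
valuation of the set `S` by the agent `i`. An allocation is a function `a` that assigns to every
agent a set of items (with unlimited supply there is no further restriction), and a pricing is a
function `p` that assigns to every set of items a price. -/

section EnvyFree

variable {n m : ℕ}

/-- The maximal utility `max_S (v i S - p S)` that the agent `i` can get. -/
noncomputable def maxUtility (v : Fin m → Finset (Fin n) → ℝ) (p : Finset (Fin n) → ℝ)
    (i : Fin m) : ℝ :=
  Finset.univ.sup' Finset.univ_nonempty fun S : Finset (Fin n) => v i S - p S

/-- The collection of the sets that give the agent `i` her maximal utility. -/
def demand (v : Fin m → Finset (Fin n) → ℝ) (p : Finset (Fin n) → ℝ) (i : Fin m) :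
    Set (Finset (Fin n)) :=
  {S | v i S - p S = maxUtility v p i}

/-- The allocation/pricing `(a, p)` is envy free. -/
def EnvyFree (v : Fin m → Finset (Fin n) → ℝ) (a : Fin m → Finset (Fin n))
    (p : Finset (Fin n) → ℝ) : Prop :=
  ∀ i, (0 < maxUtility v p i → a i ∈ demand v p i) ∧
    (maxUtility v p i = 0 → a i ∈ demand v p i ∨ a i = ∅) ∧
    (maxUtility v p i < 0 → a i = ∅)

/-- The revenue: the sum of the prices paid by the winning agents. -/
def revenue (a : Fin m → Finset (Fin n)) (p : Finset (Fin n) → ℝ) : ℝ :=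
  ∑ i with a i ≠ ∅, p (a i)

/-- `(a, p)` is an envy-free allocation/pricing with nonnegative prices, and its revenue is
maximal among all of these. -/
def IsRevenueMaximizing (v : Fin m → Finset (Fin n) → ℝ) (a : Fin m → Finset (Fin n))
    (p : Finset (Fin n) → ℝ) : Prop :=
  (∀ S, 0 ≤ p S) ∧ EnvyFree v a p ∧
    ∀ (a' : Fin m → Finset (Fin n)) (p' : Finset (Fin n) → ℝ),
      (∀ S, 0 ≤ p' S) → EnvyFree v a' p' → revenue a' p' ≤ revenue a p

end EnvyFree

/-! ## Single-minded bidders -/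

/-- `m` single-minded agents and `n` items: the agent `i` wants the nonempty set `bundle i` and
values it at `value i`. -/
structure SingleMinded where
  n : ℕ
  m : ℕ
  bundle : Fin m → Finset (Fin n)
  bundle_nonempty : ∀ i, (bundle i).Nonempty
  value : Fin m → ℚ≥0

namespace SingleMinded

/-- The valuation function of an agent: `value i` on the supersets of `bundle i`, and `0` on all
other sets. -/
noncomputable def valuation (I : SingleMinded) (i : Fin I.m) (S : Finset (Fin I.n)) : ℝ :=
  if I.bundle i ⊆ S then (I.value i : ℝ) else 0

/-- The input as a list of numbers: the number of items, the number of agents, and for each agent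
the indicator vector of her bundle followed by the numerator and the denominator of her
valuation. -/
def encode (I : SingleMinded) : List ℕ :=
  I.n :: I.m :: (List.finRange I.m).flatMap fun i =>
    ((List.finRange I.n).map fun j => if j ∈ I.bundle i then 1 else 0) ++
      [(I.value i).num, (I.value i).den]

/-- A concise description of an allocation/pricing: which agents win, the price of the bundle of
each agent (winning or not), and one price for all the other nonempty sets. -/
structure Outcome (I : SingleMinded) where
  win : Fin I.m → Bool
  price : Fin I.m → ℚ≥0
  otherPrice : ℚ≥0

/-- The output as a list of numbers: numerator and denominator of the price of the other sets,
and for each agent a win/lose bit and numerator and denominator of the price of her bundle. -/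
def Outcome.encode (I : SingleMinded) (o : Outcome I) : List ℕ :=
  o.otherPrice.num :: o.otherPrice.den :: (List.finRange I.m).flatMap fun i =>
    [if o.win i then 1 else 0, (o.price i).num, (o.price i).den]

/-- The allocation: winners get the bundle that they want, losers get nothing. -/
def Outcome.allocation {I : SingleMinded} (o : Outcome I) (i : Fin I.m) : Finset (Fin I.n) :=
  if o.win i then I.bundle i else ∅

/-- `p` is the pricing described by the outcome. (There is at most one such `p`, and none if the
outcome lists different prices for the same set.) -/
def Outcome.Describes {I : SingleMinded} (o : Outcome I) (p : Finset (Fin I.n) → ℝ) : Prop :=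
  p ∅ = 0 ∧ (∀ i, p (I.bundle i) = (o.price i : ℝ)) ∧
    ∀ S, S ≠ ∅ → (∀ i, I.bundle i ≠ S) → p S = (o.otherPrice : ℝ)

end SingleMinded

/-!
Only the price `q i` of the cheapest set that satisfies the agent `i` matters. These prices are
monotone in the bundles, an agent pays at most `gain (v i) (q i)` (which is `q i` if `q i ≤ v i`,
and `0` otherwise), and conversely monotone prices of the bundles form an envy-free pricing once
all other sets are as expensive as the highest valuation (`revenue_le_sum_gain`,
`Outcome.isRevenueMaximizing_pricing`). So the problem is to maximize `∑ i, gain (v i) (q i)` over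
the monotone vectors `q`.

Optimal prices may be rounded up to valuations of agents. A monotone vector of valuations is a
closed set in a relation on the nodes `(i, k)`, read as "`q i` is at least the valuation of `k`",
and when `(i, k)` is weighted by the increment of `gain (v i)` at the level `k`, the weights of a
closed set telescope to the total gain (`MonotonePrices.weight_eq`, `MonotonePrices.sum_gain_le`).
What remains is to find a closed set of maximum weight.

This is a minimum cut problem. It is solved by a push-relabel method without source and sink: the
weights are the initial excesses, positive excess is pushed along the arcs of the relation, which
have infinite capacity, and heights are capped at the number `N` of nodes. A potential function
bounds the number of pushes and lifts (`MaxClosure.sweeps_spec`). At the end no node below the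
height `N` has positive excess, some height `k ≤ N` does not occur, and the nodes above it are
closed and of maximum weight, because no flow enters them and all positive excess sits there
(`MaxClosure.Inv.optimal`).

For the running time, `RAM.Cmd` is a language of structured programs whose loops are counted loops
with a number of rounds that is determined by the input. If second factors in products are bounded
in terms of the input, then each elementary step adds a bounded amount to the bit lengths, and the
running time is polynomial (`RAM.Cmd.Tame.runsWithin`); nothing else about the numbers in the memory
is needed. The prices that are output are valuations of agents (or `0`), so that no fraction has to
be reduced.
-/

/-! ### Structured programs -/

namespace RAM

/-- Structured programs whose only loops are counted loops: `forTo x b c` runs the body `c` for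
`x = 0, 1, …, b - 1`. -/
inductive Cmd where
  | skip
  | assign (x : ℕ) (e : Exp)
  | store (r : ℕ) (i e : Exp)
  | seq (c d : Cmd)
  | ite (e : Exp) (c d : Cmd)
  | forTo (x : ℕ) (b : Exp) (c : Cmd)

namespace Cmd

/-- The translation into programs of the random access machine. -/
def compile : Cmd → Prog
  | skip => .skip
  | assign x e => .assign x e
  | store r i e => .store r i e
  | seq c d => .seq c.compile d.compile
  | ite e c d => .ite e c.compile d.compile
  | forTo x b c => .seq (.assign x (.const 0)) (.loop (.op .lt (.var x) b)
      (.seq c.compile (.assign x (.op .add (.var x) (.const 1)))))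

/-- The state after `k` rounds of a counted loop with counter `x`, whose body acts as `f`. -/
def rounds (x : ℕ) (f : State → State) (s : State) : ℕ → State
  | 0 => s.setVar x 0
  | k + 1 => (f (rounds x f s k)).setVar x (k + 1)

/-- The state in which a structured program halts. -/
def run : Cmd → State → State
  | skip, s => s
  | assign x e, s => s.setVar x (e.value s)
  | store r i e, s => s.setCell r (i.value s) (e.value s)
  | seq c d, s => d.run (c.run s)
  | ite e c d, s => if e.value s ≠ 0 then c.run s else d.run s
  | forTo x b c, s => rounds x c.run s (b.value s)

/-- The program may change the variable `y`. -/
def writesVar (y : ℕ) : Cmd → Bool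
  | skip => false
  | assign x _ => x == y
  | store _ _ _ => false
  | seq c d => c.writesVar y || d.writesVar y
  | ite _ c d => c.writesVar y || d.writesVar y
  | forTo x _ c => x == y || c.writesVar y

/-- The program may change the array `r`. -/
def writesArr (r : ℕ) : Cmd → Bool
  | skip => false
  | assign _ _ => false
  | store r' _ _ => r' == r
  | seq c d => c.writesArr r || d.writesArr r
  | ite _ c d => c.writesArr r || d.writesArr r
  | forTo _ _ c => c.writesArr r

end Cmd

@[simp] theorem State.setVar_var (s : State) (x v y : ℕ) :
    (s.setVar x v).var y = if y = x then v else s.var y := by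
  simp [State.setVar, Function.update_apply]

@[simp] theorem State.setVar_setVar (s : State) (x v w : ℕ) :
    (s.setVar x v).setVar x w = s.setVar x w := by
  simp [State.setVar]

@[simp] theorem State.setVar_cell (s : State) (x v : ℕ) : (s.setVar x v).cell = s.cell := rfl

@[simp] theorem State.setCell_var (s : State) (r k v : ℕ) : (s.setCell r k v).var = s.var := rfl

@[simp] theorem State.setCell_cell (s : State) (r k v q : ℕ) :
    (s.setCell r k v).cell q = if q = r then Function.update (s.cell r) k v else s.cell q := by
  by_cases h : q = r
  · subst h; simp [State.setCell]
  · simp [State.setCell, h]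

namespace Cmd

theorem run_skip (s : State) : skip.run s = s := rfl

theorem run_assign (x : ℕ) (e : Exp) (s : State) : (assign x e).run s = s.setVar x (e.value s) :=
  rfl

theorem run_store (r : ℕ) (i e : Exp) (s : State) :
    (store r i e).run s = s.setCell r (i.value s) (e.value s) := rfl

theorem run_ite (e : Exp) (c d : Cmd) (s : State) :
    (ite e c d).run s = if e.value s ≠ 0 then c.run s else d.run s := rfl

theorem rounds_var_self (x : ℕ) (f : State → State) (s : State) (k : ℕ) :
    (rounds x f s k).var x = k := by
  cases k <;> simp [rounds]

theorem run_var {y : ℕ} : ∀ {c : Cmd}, c.writesVar y = false → ∀ s, (c.run s).var y = s.var y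
  | skip, _, _ => rfl
  | assign x e, h, s => by
    have : y ≠ x := by rintro rfl; simp [writesVar] at h
    simp [run, this]
  | store _ _ _, _, _ => rfl
  | seq c d, h, s => by
    simp only [writesVar, Bool.or_eq_false_iff] at h
    simp only [run, run_var h.2, run_var h.1]
  | ite e c d, h, s => by
    simp only [writesVar, Bool.or_eq_false_iff] at h
    simp only [run]
    split
    · exact run_var h.1 s
    · exact run_var h.2 s
  | forTo x b c, h, s => by
    simp only [writesVar, Bool.or_eq_false_iff, beq_eq_false_iff_ne] at h
    simp only [run]
    induction b.value s with
    | zero => simp [rounds, h.1.symm]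
    | succ k ih => simp [rounds, h.1.symm, run_var h.2, ih]

theorem run_cell {r : ℕ} : ∀ {c : Cmd}, c.writesArr r = false → ∀ s, (c.run s).cell r = s.cell r
  | skip, _, _ => rfl
  | assign x e, h, s => rfl
  | store r' _ _, h, s => by
    have : r ≠ r' := by rintro rfl; simp [writesArr] at h
    simp [run, this]
  | seq c d, h, s => by
    simp only [writesArr, Bool.or_eq_false_iff] at h
    simp only [run, run_cell h.2, run_cell h.1]
  | ite e c d, h, s => by
    simp only [writesArr, Bool.or_eq_false_iff] at h
    simp only [run]
    split
    · exact run_cell h.1 s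
    · exact run_cell h.2 s
  | forTo x b c, h, s => by
    simp only [writesArr] at h
    simp only [run]
    induction b.value s with
    | zero => rfl
    | succ k ih => simp [rounds, run_cell h, ih]

/-- The invariant rule for counted loops. The hypothesis of the induction step records the value
of the counter, and that everything that the body does not write to is unchanged. -/
theorem forTo_induction {x : ℕ} {b : Exp} {c : Cmd} {s : State} {n : ℕ} (hn : b.value s = n)
    (P : ℕ → State → Prop)
    (h0 : P 0 (s.setVar x 0))
    (hs : ∀ k < n, ∀ s' : State, s'.var x = k →
      (∀ y, y ≠ x → c.writesVar y = false → s'.var y = s.var y) →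
      (∀ r, c.writesArr r = false → s'.cell r = s.cell r) →
      P k s' → P (k + 1) ((c.run s').setVar x (k + 1))) :
    P n ((forTo x b c).run s) := by
  subst hn
  simp only [run]
  have key : ∀ k ≤ b.value s, P k (rounds x c.run s k) := by
    intro k
    induction k with
    | zero => exact fun _ => h0
    | succ k ih =>
      intro hk
      refine hs k hk _ (rounds_var_self ..) (fun y hy hc => ?_) (fun r hc => ?_) (ih (by omega))
      · clear ih hk
        induction k with
        | zero => simp [rounds, hy]
        | succ k ih => simp [rounds, hy, run_var hc, ih]
      · clear ih hk
        induction k with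
        | zero => rfl
        | succ k ih => simp [rounds, run_cell hc, ih]
  exact key _ le_rfl

/-- The rule for loops that fill the array `r`, where the round `k` takes care of the cells in
`own k`. -/
theorem forTo_fill {x : ℕ} {b : Exp} {c : Cmd} {s : State} {n : ℕ} (hn : b.value s = n) (r : ℕ)
    {own : ℕ → ℕ → Prop} (hown : ∀ k l a, own k a → own l a → k = l) {Q : ℕ → ℕ → Prop}
    (hs : ∀ k < n, ∀ s' : State, s'.var x = k →
      (∀ y, y ≠ x → c.writesVar y = false → s'.var y = s.var y) →
      (∀ r, c.writesArr r = false → s'.cell r = s.cell r) →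
      (∀ a, own k a → Q a ((c.run s').cell r a)) ∧
        ∀ a, ¬own k a → (c.run s').cell r a = s'.cell r a) :
    (∀ k < n, ∀ a, own k a → Q a (((forTo x b c).run s).cell r a)) ∧
      ∀ a, (∀ k < n, ¬own k a) → ((forTo x b c).run s).cell r a = s.cell r a := by
  refine forTo_induction hn (fun j t => (∀ k < j, ∀ a, own k a → Q a (t.cell r a)) ∧
      ∀ a, (∀ k < j, ¬own k a) → t.cell r a = s.cell r a) ⟨by simp, fun _ _ => rfl⟩ ?_
  intro k hk s' hx hv hc ⟨h1, h2⟩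
  obtain ⟨h3, h4⟩ := hs k hk s' hx hv hc
  rw [State.setVar_cell]
  refine ⟨fun j hj a ha => ?_, fun a ha => ?_⟩
  · rcases Nat.lt_succ_iff_lt_or_eq.1 hj with hj | rfl
    · rw [h4 a fun h => hj.ne (hown _ _ _ ha h)]
      exact h1 j hj a ha
    · exact h3 a ha
  · rw [h4 a (ha k (Nat.lt_succ_self k)), h2 a fun j hj => ha j (Nat.lt_succ_of_lt hj)]

/-- The rule for loops that fill an initial segment of the array `r`. -/
theorem forTo_fill_one {x : ℕ} {b : Exp} {c : Cmd} {s : State} {n : ℕ} (hn : b.value s = n)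
    (r : ℕ) {Q : ℕ → ℕ → Prop}
    (hs : ∀ k < n, ∀ s' : State, s'.var x = k →
      (∀ y, y ≠ x → c.writesVar y = false → s'.var y = s.var y) →
      (∀ r, c.writesArr r = false → s'.cell r = s.cell r) →
      Q k ((c.run s').cell r k) ∧ ∀ a, a ≠ k → (c.run s').cell r a = s'.cell r a) :
    ∀ k < n, Q k (((forTo x b c).run s).cell r k) := fun k hk => by
  refine (forTo_fill hn r (own := fun k a => a = k) (Q := Q) (by rintro k _ a rfl rfl; rfl)
    fun k hk s' hx hv hc => ?_).1 k hk k rfl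
  obtain ⟨h1, h2⟩ := hs k hk s' hx hv hc
  exact ⟨by rintro a rfl; exact h1, h2⟩

theorem row_inj {m i j k l : ℕ} (hj : j < m) (hl : l < m) (h : i * m + j = k * m + l) :
    i = k ∧ j = l := by
  have h1 := congrArg (· / m) h
  have h2 := congrArg (· % m) h
  simp only [Nat.mul_add_mod', Nat.mod_eq_of_lt hj, Nat.mod_eq_of_lt hl] at h2
  subst h2
  exact ⟨Nat.eq_of_mul_eq_mul_right (by omega) (Nat.add_right_cancel h), rfl⟩

/-- The rule for two nested loops that fill a matrix, which is stored row by row in the array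
`r`. -/
theorem forTo_fill_two {x y : ℕ} {b₁ b₂ : Exp} {c : Cmd} {s : State} {n m : ℕ} (hxy : x ≠ y)
    (hn : b₁.value s = n) (h0 : c.writesArr 0 = false)
    (hm : ∀ s' : State, s'.cell 0 = s.cell 0 → b₂.value s' = m) (hcx : c.writesVar x = false)
    (r : ℕ) {Q : ℕ → ℕ → ℕ → Prop}
    (hs : ∀ i < n, ∀ j < m, ∀ s' : State, s'.var x = i → s'.var y = j →
      (∀ z, z ≠ x → z ≠ y → c.writesVar z = false → s'.var z = s.var z) →
      (∀ r, c.writesArr r = false → s'.cell r = s.cell r) →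
      Q i j ((c.run s').cell r (i * m + j)) ∧
        ∀ a, a ≠ i * m + j → (c.run s').cell r a = s'.cell r a) :
    ∀ i < n, ∀ j < m, Q i j (((forTo x b₁ (forTo y b₂ c)).run s).cell r (i * m + j)) := by
  intro i hi j hj
  refine (forTo_fill hn r (own := fun i a => ∃ j < m, a = i * m + j)
    (Q := fun a v => ∀ i j, j < m → a = i * m + j → Q i j v) ?_ ?_).1 i hi _ ⟨j, hj, rfl⟩ i j hj rfl
  · rintro k l a ⟨j, hj, rfl⟩ ⟨j', hj', h⟩
    exact (row_inj hj hj' h).1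
  intro i hi s' hx hv hc
  have key := forTo_fill (s := s') (x := y) (b := b₂) (c := c) (hm s' (hc 0 h0)) r
    (own := fun j a => a = i * m + j)
    (Q := fun a v => ∀ i j, j < m → a = i * m + j → Q i j v)
    (by rintro k l a rfl h; exact Nat.add_left_cancel h) ?_
  · refine ⟨?_, fun a ha => key.2 a fun k hk h => ha ⟨k, hk, h⟩⟩
    rintro a ⟨j, hj, ha⟩
    exact key.1 j hj a ha
  · intro j hj s'' hy hv' hc'
    obtain ⟨h3, h4⟩ := hs i hi j hj s'' ((hv' x hxy hcx).trans hx) hy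
      (fun z hzx hzy hz => (hv' z hzy hz).trans (hv z hzx (by
        simpa [writesVar, hz] using hzy.symm)))
      (fun r hr => (hc' r hr).trans (hc r hr))
    refine ⟨?_, h4⟩
    rintro a rfl i' j' hj' h
    obtain ⟨rfl, rfl⟩ := row_inj hj hj' h
    exact h3

end Cmd

/-! ### The running time of structured programs -/

namespace Exp

/-- Expressions whose value has a bit length that is bounded in terms of the input alone (which
is stored in the array `0`). -/
def small : Exp → Bool
  | const _ => true
  | var _ => false
  | cell r _ => r == 0
  | op .add a b => a.small && b.small
  | op .mul a b => a.small && b.small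
  | op .sub a _ => a.small
  | op .div a _ => a.small
  | op .mod a _ => a.small
  | op .eq _ _ => true
  | op .lt _ _ => true

/-- Expressions in which only small numbers occur as second factors, so that the bit length grows
additively. -/
def mild : Exp → Bool
  | const _ => true
  | var _ => true
  | cell _ i => i.mild
  | op .mul a b => a.mild && b.mild && b.small
  | op _ a b => a.mild && b.mild

/-- Expressions whose value depends on nothing but the array `0`. -/
def inputOnly : Exp → Bool
  | const _ => true
  | var _ => false
  | cell r i => r == 0 && i.inputOnly
  | op _ a b => a.inputOnly && b.inputOnly

/-- The growth of the bit length caused by an expression, up to a factor that depends on the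
input. -/
def growth : Exp → ℕ
  | const k => k.size + 1
  | var _ => 1
  | cell _ i => i.growth + 1
  | op _ a b => a.growth + b.growth + 1

/-- The cost of an expression, up to a factor that bounds the bit lengths. -/
def costFactor : Exp → ℕ
  | const k => k.size + 1
  | var _ => 1
  | cell _ i => i.costFactor + i.growth + 1
  | op _ a b => a.costFactor + b.costFactor + a.growth + b.growth + 1

theorem one_le_growth (e : Exp) : 1 ≤ e.growth := by
  cases e <;> simp [growth]

end Exp

theorem size_add_le (a b : ℕ) : (a + b).size ≤ max a.size b.size + 1 := by
  rw [Nat.size_le, pow_succ]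
  have ha := Nat.lt_size_self a
  have hb := Nat.lt_size_self b
  have h1 : 2 ^ a.size ≤ 2 ^ max a.size b.size := Nat.pow_le_pow_right two_pos (le_max_left ..)
  have h2 : 2 ^ b.size ≤ 2 ^ max a.size b.size := Nat.pow_le_pow_right two_pos (le_max_right ..)
  omega

theorem size_mul_le (a b : ℕ) : (a * b).size ≤ a.size + b.size := by
  rw [Nat.size_le, pow_add]
  exact Nat.mul_lt_mul'' (Nat.lt_size_self a) (Nat.lt_size_self b)

theorem size_ite_le (p : Prop) [Decidable p] : (if p then 1 else 0 : ℕ).size ≤ 1 := by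
  split <;> simp

/-- All numbers in the memory have at most `W` bits. -/
def State.Bounded (W : ℕ) (s : State) : Prop :=
  (∀ x, (s.var x).size ≤ W) ∧ ∀ r k, (s.cell r k).size ≤ W

theorem State.Bounded.mono {W W' : ℕ} {s : State} (h : s.Bounded W) (hW : W ≤ W') :
    s.Bounded W' :=
  ⟨fun x => (h.1 x).trans hW, fun r k => (h.2 r k).trans hW⟩

theorem State.Bounded.setVar {W : ℕ} {s : State} (h : s.Bounded W) {v : ℕ} (hv : v.size ≤ W)
    (x : ℕ) : (s.setVar x v).Bounded W := by
  refine ⟨fun y => ?_, h.2⟩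
  rw [State.setVar_var]
  split
  exacts [hv, h.1 y]

theorem State.Bounded.setCell {W : ℕ} {s : State} (h : s.Bounded W) {v : ℕ} (hv : v.size ≤ W)
    (r k : ℕ) : (s.setCell r k v).Bounded W := by
  refine ⟨h.1, fun q l => ?_⟩
  rw [State.setCell_cell]
  split
  · rw [Function.update_apply]
    split
    exacts [hv, h.2 _ _]
  · exact h.2 _ _

namespace Exp

variable {s : State} {W₀ W : ℕ}

theorem size_value_le_of_small (h₀ : ∀ k, (s.cell 0 k).size ≤ W₀) :
    ∀ {e : Exp}, e.small → (e.value s).size ≤ e.growth * (W₀ + 1)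
  | const k, _ => by simp only [value, growth]; nlinarith
  | cell r i, h => by
    obtain rfl : r = 0 := by simpa [small] using h
    have := h₀ (i.value s)
    simp only [value, growth]; nlinarith
  | op o a b, h => by
    have mono : ∀ {x y : ℕ}, x ≤ y → x.size ≤ y.size := fun h => Nat.size_le_size h
    cases o with
    | add | mul =>
      simp only [small, Bool.and_eq_true] at h
      have ha := size_value_le_of_small h₀ h.1
      have hb := size_value_le_of_small h₀ h.2
      have h1 := size_add_le (a.value s) (b.value s)
      have h2 := size_mul_le (a.value s) (b.value s)
      simp only [value, Op.apply, growth, add_mul]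
      omega
    | sub =>
      have ha := size_value_le_of_small h₀ (e := a) h
      have h1 := mono (Nat.sub_le (a.value s) (b.value s))
      simp only [value, Op.apply, growth, add_mul]
      omega
    | div =>
      have ha := size_value_le_of_small h₀ (e := a) h
      have h1 := mono (Nat.div_le_self (a.value s) (b.value s))
      simp only [value, Op.apply, growth, add_mul]
      omega
    | mod =>
      have ha := size_value_le_of_small h₀ (e := a) h
      have h1 := mono (Nat.mod_le (a.value s) (b.value s))
      simp only [value, Op.apply, growth, add_mul]
      omega
    | eq | lt =>
      have h1 := size_ite_le (a.value s = b.value s)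
      have h2 := size_ite_le (a.value s < b.value s)
      simp only [value, Op.apply, growth, add_mul]
      omega

theorem size_value_le_of_mild (h₀ : ∀ k, (s.cell 0 k).size ≤ W₀) (hs : s.Bounded W) :
    ∀ {e : Exp}, e.mild → (e.value s).size ≤ W + e.growth * (W₀ + 1)
  | const k, _ => by simp only [value, growth]; nlinarith
  | var x, _ => by have := hs.1 x; simp only [value]; omega
  | cell r i, h => by have := hs.2 r (i.value s); simp only [value]; omega
  | op o a b, h => by
    have mono : ∀ {x y : ℕ}, x ≤ y → x.size ≤ y.size := fun h => Nat.size_le_size h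
    have hab : a.mild ∧ b.mild := by cases o <;> simp_all [mild]
    have ha := size_value_le_of_mild h₀ hs hab.1
    have hb := size_value_le_of_mild h₀ hs hab.2
    have ga := a.one_le_growth
    simp only [value, growth, add_mul]
    cases o with
    | add => have h1 := size_add_le (a.value s) (b.value s); simp only [Op.apply]; omega
    | mul =>
      simp only [mild, Bool.and_eq_true] at h
      have hb := size_value_le_of_small h₀ h.2
      have h2 := size_mul_le (a.value s) (b.value s)
      simp only [Op.apply]; omega
    | sub => have h1 := mono (Nat.sub_le (a.value s) (b.value s)); simp only [Op.apply]; omega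
    | div => have h1 := mono (Nat.div_le_self (a.value s) (b.value s)); simp only [Op.apply]; omega
    | mod => have h1 := mono (Nat.mod_le (a.value s) (b.value s)); simp only [Op.apply]; omega
    | eq => have h1 := size_ite_le (a.value s = b.value s); simp only [Op.apply]; omega
    | lt => have h1 := size_ite_le (a.value s < b.value s); simp only [Op.apply]; omega

theorem cost_le_of_mild (h₀ : ∀ k, (s.cell 0 k).size ≤ W₀) (hs : s.Bounded W) :
    ∀ {e : Exp}, e.mild → e.cost s ≤ e.costFactor * (W + W₀ + 1)
  | const k, _ => by simp only [cost, costFactor]; nlinarith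
  | var x, _ => by have := hs.1 x; simp only [cost, costFactor]; omega
  | cell r i, h => by
    have h1 := hs.2 r (i.value s)
    have h2 := cost_le_of_mild h₀ hs (e := i) h
    have h3 := size_value_le_of_mild h₀ hs (e := i) h
    have gi := i.one_le_growth
    simp only [cost, costFactor]
    nlinarith [Nat.mul_le_mul_right W gi]
  | op o a b, h => by
    have hab : a.mild ∧ b.mild := by cases o <;> simp_all [mild]
    have ha := size_value_le_of_mild h₀ hs hab.1
    have hb := size_value_le_of_mild h₀ hs hab.2
    have ca := cost_le_of_mild h₀ hs hab.1
    have cb := cost_le_of_mild h₀ hs hab.2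
    have ga := a.one_le_growth
    have gb := b.one_le_growth
    simp only [cost, costFactor]
    nlinarith [Nat.mul_le_mul_right W ga, Nat.mul_le_mul_right W gb]

theorem value_eq_of_inputOnly {s s' : State} (h : s.cell 0 = s'.cell 0) :
    ∀ {e : Exp}, e.inputOnly → e.value s = e.value s'
  | const k, _ => rfl
  | cell r i, hi => by
    simp only [inputOnly, Bool.and_eq_true, beq_iff_eq] at hi
    obtain ⟨rfl, hi⟩ := hi
    simp only [value, h, value_eq_of_inputOnly h hi]
  | op o a b, hi => by
    simp only [inputOnly, Bool.and_eq_true] at hi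
    simp only [value, value_eq_of_inputOnly h hi.1, value_eq_of_inputOnly h hi.2]

end Exp

namespace Cmd

/-- The syntactic conditions under which the running time is polynomial: all expressions are mild,
the input is never overwritten, and the number of rounds of every loop is given by the input. -/
def Tame : Cmd → Bool
  | skip => true
  | assign _ e => e.mild
  | store r i e => r != 0 && i.mild && e.mild
  | seq c d => c.Tame && d.Tame
  | ite e c d => e.mild && c.Tame && d.Tame
  | forTo x b c => b.mild && b.inputOnly && !c.writesVar x && c.Tame

/-- The expressions that bound the loops of a program. -/
def loopBounds : Cmd → List Exp
  | skip => []
  | assign _ _ => []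
  | store _ _ _ => []
  | seq c d => c.loopBounds ++ d.loopBounds
  | ite _ c d => c.loopBounds ++ d.loopBounds
  | forTo _ b c => b :: c.loopBounds

theorem Tame.writesArr_zero : ∀ {c : Cmd}, c.Tame → c.writesArr 0 = false
  | skip, _ => rfl
  | assign _ _, _ => rfl
  | store r _ _, h => by
    simp only [Tame, Bool.and_eq_true, bne_iff_ne] at h
    simpa [writesArr] using h.1.1
  | seq c d, h => by
    simp only [Tame, Bool.and_eq_true] at h
    simp [writesArr, Tame.writesArr_zero h.1, Tame.writesArr_zero h.2]
  | ite _ c d, h => by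
    simp only [Tame, Bool.and_eq_true] at h
    simp [writesArr, Tame.writesArr_zero h.1.2, Tame.writesArr_zero h.2]
  | forTo _ _ c, h => by
    simp only [Tame, Bool.and_eq_true] at h
    simpa [writesArr] using Tame.writesArr_zero h.2

theorem Tame.inputOnly : ∀ {c : Cmd}, c.Tame → ∀ b ∈ c.loopBounds, b.inputOnly
  | skip, _ => by simp [loopBounds]
  | assign _ _, _ => by simp [loopBounds]
  | store r _ _, h => by simp [loopBounds]
  | seq c d, h => by
    simp only [Tame, Bool.and_eq_true] at h
    intro b hb
    rcases List.mem_append.1 hb with hb | hb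
    exacts [Tame.inputOnly h.1 b hb, Tame.inputOnly h.2 b hb]
  | ite _ c d, h => by
    simp only [Tame, Bool.and_eq_true] at h
    intro b hb
    rcases List.mem_append.1 hb with hb | hb
    exacts [Tame.inputOnly h.1.2 b hb, Tame.inputOnly h.2 b hb]
  | forTo _ _ c, h => by
    simp only [Tame, Bool.and_eq_true] at h
    intro b hb
    rcases List.mem_cons.1 hb with rfl | hb
    exacts [h.1.1.2, Tame.inputOnly h.2 b hb]

/-- `c` halts in the state given by `run`, the bit lengths grow additively by at most
`G * (W₀ + 1)`, and the cost is at most `T` times the final bound on the bit lengths. -/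
def RunsWithin (c : Cmd) (G T W₀ W : ℕ) (s : State) : Prop :=
  ∃ t, Exec c.compile s t (c.run s) ∧ t ≤ T * (W + G * (W₀ + 1) + W₀ + 1) ∧
    (c.run s).Bounded (W + G * (W₀ + 1))

/-- A tame program runs in polynomial time. The polynomials `G` and `T` depend on the program
alone; `K` bounds the number of rounds of each loop, `W₀` the bit lengths in the input, and `W`
the bit lengths in the memory at the start. -/
theorem Tame.runsWithin : ∀ {c : Cmd}, c.Tame → ∃ G T : Polynomial ℕ, ∀ (s : State) (W₀ W K : ℕ),
    (∀ k, (s.cell 0 k).size ≤ W₀) → s.Bounded W → (∀ b ∈ c.loopBounds, b.value s ≤ K) →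
      c.RunsWithin (G.eval K) (T.eval K) W₀ W s
  | skip, _ => ⟨0, 1, fun s W₀ W K _ hs _ => ⟨1, .skip s, by simp, by simpa [run] using hs⟩⟩
  | assign x e, h => by
    refine ⟨.C e.growth, .C (e.costFactor + 1), fun s W₀ W K h₀ hs _ =>
      ⟨_, .assign x e s, ?_, ?_⟩⟩
    · have := Exp.cost_le_of_mild h₀ hs h
      simp only [Polynomial.eval_C]
      nlinarith [Nat.zero_le (e.costFactor * (e.growth * (W₀ + 1)))]
    · simp only [Polynomial.eval_C]
      exact (hs.mono (by omega)).setVar (Exp.size_value_le_of_mild h₀ hs h) x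
  | store r i e, h => by
    simp only [Tame, Bool.and_eq_true] at h
    refine ⟨.C e.growth, .C (i.costFactor + e.costFactor + 1), fun s W₀ W K h₀ hs _ =>
      ⟨_, .store r i e s, ?_, ?_⟩⟩
    · have h1 := Exp.cost_le_of_mild h₀ hs h.2
      have h2 := Exp.cost_le_of_mild h₀ hs h.1.2
      simp only [Polynomial.eval_C]
      nlinarith [Nat.zero_le (e.costFactor * (e.growth * (W₀ + 1))),
        Nat.zero_le (i.costFactor * (e.growth * (W₀ + 1)))]
    · simp only [Polynomial.eval_C]
      exact (hs.mono (by omega)).setCell (Exp.size_value_le_of_mild h₀ hs h.2) r _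
  | seq c d, h => by
    simp only [Tame, Bool.and_eq_true] at h
    obtain ⟨G₁, T₁, H₁⟩ := Tame.runsWithin h.1
    obtain ⟨G₂, T₂, H₂⟩ := Tame.runsWithin h.2
    refine ⟨G₁ + G₂, T₁ + T₂, fun s W₀ W K h₀ hs hb => ?_⟩
    obtain ⟨t₁, e₁, b₁, s₁⟩ := H₁ s W₀ W K h₀ hs fun b h => hb b (List.mem_append_left _ h)
    have hcell := run_cell (Tame.writesArr_zero h.1) s
    obtain ⟨t₂, e₂, b₂, s₂⟩ := H₂ (c.run s) W₀ _ K (by simpa [hcell] using h₀) s₁ fun b h' => by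
      rw [Exp.value_eq_of_inputOnly hcell (Tame.inputOnly h.2 b h')]
      exact hb b (List.mem_append_right _ h')
    refine ⟨_, .seq e₁ e₂, ?_, s₂.mono ?_⟩
    · simp only [Polynomial.eval_add]
      nlinarith [Nat.zero_le (T₁.eval K * (G₂.eval K * (W₀ + 1)))]
    · simp only [Polynomial.eval_add, add_mul]; omega
  | ite e c d, h => by
    simp only [Tame, Bool.and_eq_true] at h
    obtain ⟨G₁, T₁, H₁⟩ := Tame.runsWithin h.1.2
    obtain ⟨G₂, T₂, H₂⟩ := Tame.runsWithin h.2
    refine ⟨G₁ + G₂, T₁ + T₂ + .C (e.costFactor + 1), fun s W₀ W K h₀ hs hb => ?_⟩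
    have he := Exp.cost_le_of_mild h₀ hs h.1.1
    simp only [RunsWithin, Polynomial.eval_add, Polynomial.eval_C, run]
    by_cases hv : e.value s = 0
    · obtain ⟨t, e', b', s'⟩ := H₂ s W₀ W K h₀ hs fun b h => hb b (List.mem_append_right _ h)
      simp only [hv, ne_eq, not_true_eq_false, if_false]
      refine ⟨_, .ite_false hv e', ?_, s'.mono ?_⟩
      · generalize e.costFactor = f at *
        generalize G₁.eval K = g₁ at *
        generalize G₂.eval K = g₂ at *
        generalize T₁.eval K = t₁ at *
        generalize T₂.eval K = t₂ at *
        nlinarith [Nat.zero_le (t₁ * (W + (g₁ + g₂) * (W₀ + 1) + W₀ + 1)),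
          Nat.zero_le (t₂ * (g₁ * (W₀ + 1))), Nat.zero_le (f * ((g₁ + g₂) * (W₀ + 1))),
          Nat.zero_le ((g₁ + g₂) * (W₀ + 1))]
      · simp only [add_mul]; omega
    · obtain ⟨t, e', b', s'⟩ := H₁ s W₀ W K h₀ hs fun b h => hb b (List.mem_append_left _ h)
      simp only [hv, ne_eq, not_false_eq_true, if_true]
      refine ⟨_, .ite_true hv e', ?_, s'.mono ?_⟩
      · generalize e.costFactor = f at *
        generalize G₁.eval K = g₁ at *
        generalize G₂.eval K = g₂ at *
        generalize T₁.eval K = t₁ at *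
        generalize T₂.eval K = t₂ at *
        nlinarith [Nat.zero_le (t₂ * (W + (g₁ + g₂) * (W₀ + 1) + W₀ + 1)),
          Nat.zero_le (t₁ * (g₂ * (W₀ + 1))), Nat.zero_le (f * ((g₁ + g₂) * (W₀ + 1))),
          Nat.zero_le ((g₁ + g₂) * (W₀ + 1))]
      · simp only [add_mul]; omega
  | forTo x b c, h => by
    simp only [Tame, Bool.and_eq_true, Bool.not_eq_true'] at h
    obtain ⟨⟨⟨hbm, hbi⟩, hx⟩, hc⟩ := h
    obtain ⟨G₁, T₁, H₁⟩ := Tame.runsWithin hc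
    set cond : Exp := .op .lt (.var x) b with hcond
    have hcm : cond.mild := by simp [hcond, Exp.mild, hbm]
    have hinc : (Exp.op .add (.var x) (.const 1)).mild := rfl
    refine ⟨.X * (G₁ + 4), .X * (T₁ + .C (cond.costFactor + 20)) + .C (cond.costFactor + 20),
      fun s W₀ W K h₀ hs hb => ?_⟩
    have hbK : b.value s ≤ K := hb b (by simp [loopBounds])
    set g := G₁.eval K with hg
    set τ := T₁.eval K with hτ
    set f := cond.costFactor with hf
    set M := W + K * (g + 4) * (W₀ + 1) with hM
    set L := rounds x c.run s with hL
    have L0 : ∀ k, (L k).cell 0 = s.cell 0 := by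
      intro k
      induction k with
      | zero => rfl
      | succ k ih => simpa [hL, rounds, run_cell (Tame.writesArr_zero hc)] using ih
    have L0' : ∀ k j, ((L k).cell 0 j).size ≤ W₀ := fun k => by rw [L0]; exact h₀
    have Lx : ∀ k, (L k).var x = k := fun k => rounds_var_self ..
    -- one round: the body together with the increment of the counter
    have round : ∀ k, k < b.value s → (L k).Bounded (W + k * (g + 4) * (W₀ + 1)) →
        (L (k + 1)).Bounded (W + (k + 1) * (g + 4) * (W₀ + 1)) ∧
        ∃ t, Exec (.seq c.compile (.assign x (.op .add (.var x) (.const 1)))) (L k) t (L (k + 1)) ∧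
          t ≤ (τ + 10) * (M + W₀ + 1) := by
      intro k hk hB
      have hkK : W + (k + 1) * (g + 4) * (W₀ + 1) ≤ M := by
        have : (k + 1) * ((g + 4) * (W₀ + 1)) ≤ K * ((g + 4) * (W₀ + 1)) :=
          Nat.mul_le_mul_right _ (hk.trans_le hbK)
        rw [hM]; simp only [mul_assoc]; omega
      obtain ⟨t, e', b', s'⟩ := H₁ (L k) W₀ _ K (L0' k) hB fun b' h' => by
        rw [Exp.value_eq_of_inputOnly (L0 k) (Tame.inputOnly hc b' h')]
        exact hb b' (by simp [loopBounds, h'])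
      rw [← hg, ← hτ] at b'
      rw [← hg] at s'
      have h₀' : ∀ j, ((c.run (L k)).cell 0 j).size ≤ W₀ := by
        rw [run_cell (Tame.writesArr_zero hc)]; exact L0' k
      have i1 := Exp.cost_le_of_mild h₀' s' hinc
      have i2 := Exp.size_value_le_of_mild h₀' s' hinc
      have hLs : L (k + 1) = (c.run (L k)).setVar x
          ((Exp.op .add (.var x) (.const 1)).value (c.run (L k))) := by
        simp [hL, rounds, Exp.value, Op.apply, run_var hx, rounds_var_self]
      simp only [Exp.costFactor, Exp.growth, Nat.size_one] at i1 i2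
      have hle : W + k * (g + 4) * (W₀ + 1) + g * (W₀ + 1) + 4 * (W₀ + 1) ≤
          W + (k + 1) * (g + 4) * (W₀ + 1) := le_of_eq (by ring)
      refine ⟨?_, t + ((Exp.op .add (.var x) (.const 1)).cost (c.run (L k)) + 1), ?_, ?_⟩
      · rw [hLs]
        exact (s'.mono (by omega)).setVar (by omega) x
      · rw [hLs]; exact .seq e' (.assign ..)
      · have : t ≤ τ * (M + W₀ + 1) := b'.trans (Nat.mul_le_mul_left _ (by omega))
        have h10 : (τ + 10) * (M + W₀ + 1) = τ * (M + W₀ + 1) + 10 * (M + W₀ + 1) := by ring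
        omega
    have hsize : ∀ k ≤ b.value s, (L k).Bounded (W + k * (g + 4) * (W₀ + 1)) := by
      intro k
      induction k with
      | zero => intro _; simpa [hL, rounds] using hs.setVar (v := 0) (by simp) x
      | succ k ih => exact fun hk => (round k hk (ih (by omega))).1
    have hsizeM : ∀ k ≤ b.value s, (L k).Bounded M := fun k hk => (hsize k hk).mono (by
      have : k * ((g + 4) * (W₀ + 1)) ≤ K * ((g + 4) * (W₀ + 1)) :=
        Nat.mul_le_mul_right _ (hk.trans hbK)
      rw [hM]; simp only [mul_assoc]; omega)
    have hcost : ∀ k ≤ b.value s, cond.cost (L k) ≤ f * (M + W₀ + 1) := fun k hk =>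
      Exp.cost_le_of_mild (L0' k) (hsizeM k hk) hcm
    have hval : ∀ k, cond.value (L k) = if k < b.value s then 1 else 0 := fun k => by
      simp [hcond, Exp.value, Op.apply, Lx, Exp.value_eq_of_inputOnly (L0 k) hbi]
    have loop : ∀ j k, k + j = b.value s → ∃ t, Exec (.loop cond
        (.seq c.compile (.assign x (.op .add (.var x) (.const 1))))) (L k) t (L (b.value s)) ∧
        t ≤ j * ((τ + f + 11) * (M + W₀ + 1)) + (f + 1) * (M + W₀ + 1) := by
      intro j
      induction j with
      | zero =>
        rintro k hk
        obtain rfl : k = b.value s := by omega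
        refine ⟨_, .loop_done (by simp [hval]), ?_⟩
        have := hcost _ le_rfl
        rw [add_mul f]; omega
      | succ j ih =>
        intro k hk
        obtain ⟨-, t₁, e₁, b₁⟩ := round k (by omega) (hsize k (by omega))
        obtain ⟨t₂, e₂, b₂⟩ := ih (k + 1) (by omega)
        refine ⟨_, .loop_step (by simp [hval]; omega) e₁ e₂, ?_⟩
        have h1 := hcost k (by omega)
        have : (j + 1) * ((τ + f + 11) * (M + W₀ + 1)) = j * ((τ + f + 11) * (M + W₀ + 1)) +
          ((τ + 10) * (M + W₀ + 1) + f * (M + W₀ + 1) + (M + W₀ + 1)) := by ring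
        omega
    obtain ⟨t, e', b'⟩ := loop (b.value s) 0 (by omega)
    have hGe : (Polynomial.X * (G₁ + 4)).eval K = K * (g + 4) := by simp [hg]
    refine ⟨_, .seq (.assign x (.const 0) s) e', ?_, ?_⟩
    · rw [hGe, ← hM]
      have h1 : (Polynomial.X * (T₁ + Polynomial.C (f + 20)) + Polynomial.C (f + 20)).eval K =
          K * (τ + (f + 20)) + (f + 20) := by simp [hτ]
      rw [h1]
      have h2 : b.value s * ((τ + f + 11) * (M + W₀ + 1)) ≤
          K * ((τ + (f + 20)) * (M + W₀ + 1)) :=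
        Nat.mul_le_mul hbK (Nat.mul_le_mul_right _ (by omega))
      have h3 : (K * (τ + (f + 20)) + (f + 20)) * (M + W₀ + 1) =
        K * ((τ + (f + 20)) * (M + W₀ + 1)) + (f + 1) * (M + W₀ + 1) + 19 * (M + W₀ + 1) := by
        ring
      simp only [Exp.cost, Nat.size_zero]
      omega
    · rw [hGe, ← hM]
      exact hsizeM _ le_rfl

end Cmd

end RAM

/-! ### Maximum closures by a push-relabel method -/

namespace MaxClosure

open Finset

/-- The state of the push-relabel method on the nodes `0, …, N - 1`: the content `E u` of each
node, its height `H u`, and the amount `F u v` that has been moved along the arc from `u` to `v`.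
The contents are shifted by a constant `B`, so that they are natural numbers: the excess of `u`
is `E u - B`, which may be negative. -/
structure Preflow where
  E : ℕ → ℕ
  H : ℕ → ℕ
  F : ℕ → ℕ → ℕ

/-- The start of the method: no flow, and all heights are `0`. -/
def Preflow.init (E₀ : ℕ → ℕ) : Preflow := ⟨E₀, fun _ => 0, fun _ _ => 0⟩

variable {N B : ℕ} {R : ℕ → ℕ → Prop} {E₀ : ℕ → ℕ} {σ : Preflow}

/-- The node `u` has positive excess and is not yet at the top height `N`. -/
def Active (N B : ℕ) (σ : Preflow) (u : ℕ) : Prop := B < σ.E u ∧ σ.H u < N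

/-- The residual arc from `u` to `v` (either an arc of the relation, whose capacity is infinite, or
the reverse of an arc that carries flow) leads one step down. -/
def Adm (R : ℕ → ℕ → Prop) (σ : Preflow) (u v : ℕ) : Prop :=
  σ.H u = σ.H v + 1 ∧ (R u v ∨ 0 < σ.F v u)

open Classical in
/-- The amount that is pushed from `u` to `v`: all of the excess, but not more than the flow that
can be cancelled if there is no arc from `u` to `v`. -/
noncomputable def amount (B : ℕ) (R : ℕ → ℕ → Prop) (σ : Preflow) (u v : ℕ) : ℕ :=
  if R u v then σ.E u - B else min (σ.E u - B) (σ.F v u)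

open Classical in
/-- Push from `u` to `v` if `u` is active and the residual arc is admissible. -/
noncomputable def push (N B : ℕ) (R : ℕ → ℕ → Prop) (u v : ℕ) (σ : Preflow) : Preflow :=
  if Active N B σ u ∧ Adm R σ u v then
    { E := Function.update (Function.update σ.E u (σ.E u - amount B R σ u v)) v
        (σ.E v + amount B R σ u v)
      H := σ.H
      F := fun a b =>
        if R u v then (if a = u ∧ b = v then σ.F u v + amount B R σ u v else σ.F a b)
        else (if a = v ∧ b = u then σ.F v u - amount B R σ u v else σ.F a b) }
  else σ

open Classical in
/-- Lift `u` by one if it is active. -/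
noncomputable def relabel (N B : ℕ) (u : ℕ) (σ : Preflow) : Preflow :=
  if Active N B σ u then { σ with H := Function.update σ.H u (σ.H u + 1) } else σ

/-- Push from `u` to the nodes below `k`, one after the other. -/
noncomputable def pushes (N B : ℕ) (R : ℕ → ℕ → Prop) (u : ℕ) (σ : Preflow) : ℕ → Preflow
  | 0 => σ
  | k + 1 => push N B R u k (pushes N B R u σ k)

/-- Push from `u` along all arcs, and lift `u` if it is still active. -/
noncomputable def discharge (N B : ℕ) (R : ℕ → ℕ → Prop) (u : ℕ) (σ : Preflow) : Preflow :=
  relabel N B u (pushes N B R u σ N)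

/-- Discharge the nodes below `k`, one after the other. -/
noncomputable def discharges (N B : ℕ) (R : ℕ → ℕ → Prop) (σ : Preflow) : ℕ → Preflow
  | 0 => σ
  | k + 1 => discharge N B R k (discharges N B R σ k)

/-- The state after `k` sweeps over all nodes. -/
noncomputable def sweeps (N B : ℕ) (R : ℕ → ℕ → Prop) (σ : Preflow) : ℕ → Preflow
  | 0 => σ
  | k + 1 => discharges N B R (sweeps N B R σ k) N

/-- The invariant of the method. -/
structure Inv (N B : ℕ) (R : ℕ → ℕ → Prop) (E₀ : ℕ → ℕ) (σ : Preflow) : Prop where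
  conservation : ∀ u < N, σ.E u + ∑ v ∈ range N, σ.F u v = E₀ u + ∑ v ∈ range N, σ.F v u
  height_arc : ∀ u < N, ∀ v < N, R u v → σ.H u ≤ σ.H v + 1
  height_flow : ∀ u < N, ∀ v < N, 0 < σ.F v u → σ.H u ≤ σ.H v + 1
  flow_arc : ∀ u < N, ∀ v < N, 0 < σ.F u v → R u v
  height_neg : ∀ u < N, σ.E u < B → σ.H u = 0
  height_le : ∀ u < N, σ.H u ≤ N

theorem Inv.init : Inv N B R E₀ (.init E₀) := by
  constructor <;> simp [Preflow.init]

theorem Adm.ne {u v : ℕ} (h : Adm R σ u v) : u ≠ v := by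
  rintro rfl
  have := h.1
  omega

theorem amount_le (u v : ℕ) : amount B R σ u v ≤ σ.E u - B := by
  unfold amount
  split
  exacts [le_rfl, min_le_left ..]

theorem push_H (u v : ℕ) : (push N B R u v σ).H = σ.H := by
  unfold push
  split <;> rfl

theorem push_eq_self {u v : ℕ} (h : ¬(Active N B σ u ∧ Adm R σ u v)) : push N B R u v σ = σ :=
  if_neg h

theorem push_E_self {u v : ℕ} (hu : Active N B σ u) (h : Adm R σ u v) :
    (push N B R u v σ).E u = σ.E u - amount B R σ u v := by
  simp [push, hu, h, h.ne]

theorem push_E_target {u v : ℕ} (hu : Active N B σ u) (h : Adm R σ u v) :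
    (push N B R u v σ).E v = σ.E v + amount B R σ u v := by
  simp [push, hu, h]

theorem push_E_of_ne {u v x : ℕ} (h1 : x ≠ u) (h2 : x ≠ v) :
    (push N B R u v σ).E x = σ.E x := by
  unfold push
  split
  · simp [h1, h2]
  · rfl

theorem push_F_of_arc {u v : ℕ} (hu : Active N B σ u) (h : Adm R σ u v) (hR : R u v) (a b : ℕ) :
    (push N B R u v σ).F a b =
      σ.F a b + if a = u then (if b = v then amount B R σ u v else 0) else 0 := by
  simp only [push, hu, h, hR, and_self, if_true]
  by_cases ha : a = u <;> by_cases hb : b = v <;> simp [ha, hb]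

theorem push_F_of_not_arc {u v : ℕ} (hu : Active N B σ u) (h : Adm R σ u v) (hR : ¬R u v)
    (a b : ℕ) : (push N B R u v σ).F a b +
      (if a = v then (if b = u then amount B R σ u v else 0) else 0) = σ.F a b := by
  have : amount B R σ u v ≤ σ.F v u := by simp [amount, hR]
  simp only [push, hu, h, hR, and_self, if_true, if_false]
  by_cases ha : a = v <;> by_cases hb : b = u <;> simp [ha, hb, this]

/-- A push out of `u` creates no residual arc out of `u`. -/
theorem push_F_le {u v : ℕ} (hu : Active N B σ u) (h : Adm R σ u v) (x : ℕ) :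
    (push N B R u v σ).F x u ≤ σ.F x u := by
  by_cases hR : R u v
  · simp [push_F_of_arc hu h hR, h.ne]
  · have := push_F_of_not_arc hu h hR x u
    omega

/-- If excess remains at `u` after a push, then the arc has been saturated. -/
theorem not_adm_push {u v : ℕ} (hu : Active N B σ u) (h : Adm R σ u v)
    (hE : B < (push N B R u v σ).E u) : ¬Adm R (push N B R u v σ) u v := by
  rw [push_E_self hu h] at hE
  have hR : ¬R u v := by
    intro hR
    have := hu.1
    simp only [amount, hR, if_true] at hE
    omega
  have h1 := push_F_of_not_arc hu h hR v u
  have h2 : amount B R σ u v = min (σ.E u - B) (σ.F v u) := by simp [amount, hR]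
  simp only [if_true] at h1
  rintro ⟨-, h3 | h3⟩
  · exact hR h3
  · omega

theorem Inv.push (hσ : Inv N B R E₀ σ) {u v : ℕ} (hu : u < N) (hv : v < N) :
    Inv N B R E₀ (push N B R u v σ) := by
  by_cases h : Active N B σ u ∧ Adm R σ u v
  swap
  · rwa [push_eq_self h]
  obtain ⟨ha, h⟩ := h
  have hle : amount B R σ u v ≤ σ.E u - B := amount_le u v
  have hB := ha.1
  have hne := h.ne
  have hH := push_H (N := N) (B := B) (R := R) (σ := σ) u v
  constructor
  · intro x hx
    have hc := hσ.conservation x hx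
    have hE : (MaxClosure.push N B R u v σ).E x + (if x = u then amount B R σ u v else 0) =
        σ.E x + if x = v then amount B R σ u v else 0 := by
      by_cases h1 : x = u
      · subst h1; rw [push_E_self ha h]; simp only [if_true, if_neg hne]; omega
      · by_cases h2 : x = v
        · subst h2; rw [push_E_target ha h]; simp [h1]
        · rw [push_E_of_ne h1 h2]; simp [h1, h2]
    by_cases hR : R u v
    · have e1 : ∑ y ∈ range N, (MaxClosure.push N B R u v σ).F x y =
          ∑ y ∈ range N, σ.F x y + if x = u then amount B R σ u v else 0 := by
        simp only [push_F_of_arc ha h hR, sum_add_distrib]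
        by_cases h1 : x = u <;> simp [h1, hv]
      have e2 : ∑ y ∈ range N, (MaxClosure.push N B R u v σ).F y x =
          ∑ y ∈ range N, σ.F y x + if x = v then amount B R σ u v else 0 := by
        simp only [push_F_of_arc ha h hR, sum_add_distrib]
        by_cases h1 : x = v <;> simp [h1, hu]
      omega
    · have e1 : ∑ y ∈ range N, (MaxClosure.push N B R u v σ).F x y +
          (if x = v then amount B R σ u v else 0) = ∑ y ∈ range N, σ.F x y := by
        simp only [← push_F_of_not_arc ha h hR, sum_add_distrib]
        by_cases h1 : x = v <;> simp [h1, hu]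
      have e2 : ∑ y ∈ range N, (MaxClosure.push N B R u v σ).F y x +
          (if x = u then amount B R σ u v else 0) = ∑ y ∈ range N, σ.F y x := by
        simp only [← push_F_of_not_arc ha h hR, sum_add_distrib]
        by_cases h1 : x = u <;> simp [h1, hv]
      omega
  · rw [hH]; exact hσ.height_arc
  · rw [hH]
    intro x hx y hy hF
    by_cases h0 : 0 < σ.F y x
    · exact hσ.height_flow x hx y hy h0
    · by_cases hR : R u v
      · rw [push_F_of_arc ha h hR] at hF
        split_ifs at hF with h1 h2
        · subst h1 h2; have := h.1; omega
        · omega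
        · omega
      · have := push_F_of_not_arc ha h hR y x
        omega
  · intro x hx y hy hF
    by_cases h0 : 0 < σ.F x y
    · exact hσ.flow_arc x hx y hy h0
    · by_cases hR : R u v
      · rw [push_F_of_arc ha h hR] at hF
        split_ifs at hF with h1 h2
        · subst h1 h2; exact hR
        · omega
        · omega
      · have := push_F_of_not_arc ha h hR x y
        omega
  · rw [hH]
    intro x hx hE
    by_cases h1 : x = u
    · subst h1; rw [push_E_self ha h] at hE; omega
    · by_cases h2 : x = v
      · subst h2; rw [push_E_target ha h] at hE; exact hσ.height_neg x hx (by omega)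
      · rw [push_E_of_ne h1 h2] at hE; exact hσ.height_neg x hx hE
  · rw [hH]; exact hσ.height_le

theorem Inv.relabel (hσ : Inv N B R E₀ σ) {u : ℕ}
    (h : Active N B σ u → ∀ v < N, ¬Adm R σ u v) : Inv N B R E₀ (relabel N B u σ) := by
  unfold MaxClosure.relabel
  split
  swap
  · exact hσ
  rename_i ha
  have hu := h ha
  constructor
  · exact hσ.conservation
  · intro x hx y hy hR
    have h1 := hσ.height_arc x hx y hy hR
    simp only [Function.update_apply]
    by_cases hxu : x = u
    · subst hxu
      have h2 : σ.H x ≠ σ.H y + 1 := fun h => hu y hy ⟨h, .inl hR⟩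
      split_ifs <;> omega
    · split_ifs <;> subst_vars <;> omega
  · intro x hx y hy hF
    have h1 := hσ.height_flow x hx y hy hF
    simp only [Function.update_apply]
    by_cases hxu : x = u
    · subst hxu
      have h2 : σ.H x ≠ σ.H y + 1 := fun h => hu y hy ⟨h, .inr hF⟩
      split_ifs <;> omega
    · split_ifs <;> subst_vars <;> omega
  · exact hσ.flow_arc
  · intro x hx hE
    have h1 := hσ.height_neg x hx hE
    have h2 := ha.1
    simp only [Function.update_apply]
    split_ifs with hxu
    · subst hxu; dsimp only at hE; omega
    · exact h1
  · intro x hx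
    have h1 := hσ.height_le x hx
    have h2 := ha.2
    simp only [Function.update_apply]
    split_ifs <;> omega

/-! ### The number of sweeps -/

open Classical in
/-- The admissible residual arcs. -/
noncomputable def admArcs (N : ℕ) (R : ℕ → ℕ → Prop) (σ : Preflow) : Finset (ℕ × ℕ) :=
  (range N ×ˢ range N).filter fun a => Adm R σ a.1 a.2

/-- The sum of the heights of the nodes with positive excess. -/
def activeHeight (N B : ℕ) (σ : Preflow) : ℕ :=
  ∑ u ∈ range N, if B < σ.E u then σ.H u else 0

/-- The number of units that a lift of a node contributes to the potential. -/
def liftWeight (N : ℕ) : ℕ := (N + 1) * N + 2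

/-- The potential function that decreases with each push and each lift. A lift may create `N`
admissible arcs. A push that saturates an arc destroys an admissible arc, and raises the sum of the
heights of the nodes with excess by at most `N`. Every other push moves excess down. -/
noncomputable def potential (N B : ℕ) (R : ℕ → ℕ → Prop) (σ : Preflow) : ℕ :=
  liftWeight N * (∑ u ∈ range N, (N - σ.H u)) + (N + 1) * #(admArcs N R σ) + activeHeight N B σ

theorem potential_init : potential N B R (.init E₀) = liftWeight N * (N * N) := by
  have h : activeHeight N B (.init E₀) = 0 := sum_eq_zero fun u _ => by split_ifs <;> rfl
  rw [potential, h]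
  simp [Preflow.init, admArcs, Adm]

theorem mem_admArcs {a : ℕ × ℕ} :
    a ∈ admArcs N R σ ↔ (a.1 < N ∧ a.2 < N) ∧ Adm R σ a.1 a.2 := by
  simp [admArcs]

theorem admArcs_push_subset {u v : ℕ} (hu : Active N B σ u) (h : Adm R σ u v) :
    admArcs N R (push N B R u v σ) ⊆ admArcs N R σ := by
  rintro ⟨x, y⟩ hxy
  rw [mem_admArcs] at hxy ⊢
  refine ⟨hxy.1, ?_⟩
  have hH := push_H (N := N) (B := B) (R := R) (σ := σ) u v
  obtain ⟨h1, h2⟩ := hxy.2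
  rw [hH] at h1
  refine ⟨h1, h2.imp_right fun h3 => ?_⟩
  dsimp only at h1 h3 ⊢
  by_cases hR : R u v
  · rw [push_F_of_arc hu h hR] at h3
    split_ifs at h3 with h4 h5
    · subst h4 h5; have := h.1; omega
    · omega
    · omega
  · have := push_F_of_not_arc hu h hR y x
    omega

theorem potential_push_lt (hσ : Inv N B R E₀ σ) {u v : ℕ} (huN : u < N) (hvN : v < N)
    (hu : Active N B σ u) (h : Adm R σ u v) :
    potential N B R (push N B R u v σ) < potential N B R σ := by
  have hsub := admArcs_push_subset hu h
  have hH := push_H (N := N) (B := B) (R := R) (σ := σ) u v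
  have huB := hu.1
  have hvle := hσ.height_le v hvN
  have hsum : ∀ (c : ℕ) (x : ℕ), x < N → ∑ y ∈ range N, (if y = x then c else 0) = c := by
    intro c x hx; simp [hx]
  unfold potential
  rw [hH]
  by_cases hE : B < (push N B R u v σ).E u
  · have hlt : #(admArcs N R (push N B R u v σ)) < #(admArcs N R σ) := by
      refine card_lt_card ⟨hsub, fun h' => not_adm_push hu h hE ?_⟩
      exact (mem_admArcs.1 (h' (mem_admArcs.2 ⟨⟨huN, hvN⟩, h⟩) : (u, v) ∈ _)).2
    have hA : activeHeight N B (push N B R u v σ) ≤ activeHeight N B σ + σ.H v := by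
      unfold activeHeight
      rw [← hsum (σ.H v) v hvN, ← sum_add_distrib, hH]
      refine sum_le_sum fun x _ => ?_
      by_cases h1 : x = u
      · subst h1; simp [hE, huB]
      · by_cases h2 : x = v
        · subst h2; split_ifs <;> omega
        · rw [push_E_of_ne h1 h2]; omega
    have := Nat.mul_le_mul_left (N + 1) hlt
    rw [Nat.mul_succ] at this
    omega
  · have hA : activeHeight N B (push N B R u v σ) + σ.H u ≤ activeHeight N B σ + σ.H v := by
      unfold activeHeight
      rw [← hsum (σ.H v) v hvN, ← hsum (σ.H u) u huN, ← sum_add_distrib, ← sum_add_distrib, hH]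
      refine sum_le_sum fun x _ => ?_
      by_cases h1 : x = u
      · subst h1; simp [hE, huB]
      · by_cases h2 : x = v
        · subst h2; split_ifs <;> omega
        · rw [push_E_of_ne h1 h2]; simp [h1]
    have := Nat.mul_le_mul_left (N + 1) (card_le_card hsub)
    have := h.1
    omega

theorem potential_relabel_lt (hσ : Inv N B R E₀ σ) {u : ℕ} (huN : u < N) (hu : Active N B σ u) :
    potential N B R (relabel N B u σ) < potential N B R σ := by
  have hsum : ∀ (c : ℕ), ∑ y ∈ range N, (if y = u then c else 0) = c := by
    intro c; simp [huN]
  have huH := hu.2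
  rw [relabel, if_pos hu]
  unfold potential
  set σ' : Preflow := { σ with H := Function.update σ.H u (σ.H u + 1) } with hσ'
  have h1 : ∑ x ∈ range N, (N - σ'.H x) + 1 = ∑ x ∈ range N, (N - σ.H x) := by
    conv_lhs => rw [← hsum 1, ← sum_add_distrib]
    refine sum_congr rfl fun x _ => ?_
    simp only [hσ', Function.update_apply]
    split_ifs with hx
    · subst hx; omega
    · omega
  have h2 : #(admArcs N R σ') ≤ #(admArcs N R σ) + N := by
    have : admArcs N R σ' ⊆ admArcs N R σ ∪ ({u} ×ˢ range N) := by
      rintro ⟨x, y⟩ hxy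
      rw [mem_admArcs] at hxy
      rw [mem_union, mem_product, mem_singleton, mem_range, mem_admArcs]
      obtain ⟨⟨hx, hy⟩, h3, h4⟩ := hxy
      by_cases hxu : x = u
      · exact .inr ⟨hxu, hy⟩
      · by_cases hyu : y = u
        · subst hyu
          simp only [hσ', Function.update_apply, hxu, if_false, if_true] at h3
          have := h4.elim (hσ.height_arc x hx y hy) (hσ.height_flow x hx y hy)
          omega
        · left
          simp only [hσ', Function.update_apply, hxu, hyu, if_false] at h3
          exact ⟨⟨hx, hy⟩, h3, h4⟩
    refine (card_le_card this).trans ((card_union_le ..).trans ?_)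
    simp
  have h3 : activeHeight N B σ' ≤ activeHeight N B σ + 1 := by
    unfold activeHeight
    rw [← hsum 1, ← sum_add_distrib]
    refine sum_le_sum fun x _ => ?_
    simp only [hσ', Function.update_apply]
    split_ifs <;> subst_vars <;> omega
  have h4 := Nat.mul_le_mul_left (N + 1) h2
  rw [← h1, Nat.mul_succ]
  have h5 : liftWeight N = (N + 1) * N + 2 := rfl
  rw [mul_add] at h4
  omega

/-- Pushing out of `u` along the arcs to all nodes below `k` leaves no admissible arc to these
nodes, unless `u` has become inactive. -/
theorem pushes_spec (hσ : Inv N B R E₀ σ) {u : ℕ} (hu : u < N) {k : ℕ} (hk : k ≤ N) :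
    Inv N B R E₀ (pushes N B R u σ k) ∧
    (pushes N B R u σ k = σ ∨ potential N B R (pushes N B R u σ k) < potential N B R σ) ∧
    (Active N B (pushes N B R u σ k) u → ∀ v < k, ¬Adm R (pushes N B R u σ k) u v) := by
  induction k with
  | zero => exact ⟨hσ, .inl rfl, fun _ v hv => absurd hv (Nat.not_lt_zero v)⟩
  | succ k ih =>
    obtain ⟨h1, h2, h3⟩ := ih (by omega)
    rw [pushes]
    set ρ := pushes N B R u σ k
    by_cases h : Active N B ρ u ∧ Adm R ρ u k
    · refine ⟨h1.push hu (by omega), .inr ?_, fun ha v hv => ?_⟩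
      · have := potential_push_lt h1 hu (by omega) h.1 h.2
        rcases h2 with h2 | h2
        · rwa [h2] at this ⊢
        · exact this.trans h2
      · rcases Nat.lt_succ_iff_lt_or_eq.1 hv with hv | rfl
        · rintro ⟨h4, h5⟩
          rw [push_H] at h4
          exact h3 h.1 v hv ⟨h4, h5.imp_right fun h6 => h6.trans_le (push_F_le h.1 h.2 v)⟩
        · exact not_adm_push h.1 h.2 ha.1
    · rw [push_eq_self h]
      refine ⟨h1, h2, fun ha v hv => ?_⟩
      rcases Nat.lt_succ_iff_lt_or_eq.1 hv with hv | rfl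
      · exact h3 ha v hv
      · exact fun h4 => h ⟨ha, h4⟩

theorem discharge_spec (hσ : Inv N B R E₀ σ) {u : ℕ} (hu : u < N) :
    Inv N B R E₀ (discharge N B R u σ) ∧
    ((discharge N B R u σ = σ ∧ ¬Active N B σ u) ∨
      potential N B R (discharge N B R u σ) < potential N B R σ) := by
  obtain ⟨h1, h2, h3⟩ := pushes_spec hσ hu le_rfl
  refine ⟨h1.relabel h3, ?_⟩
  by_cases h : Active N B (pushes N B R u σ N) u
  · right
    have := potential_relabel_lt h1 hu h
    rcases h2 with h2 | h2
    · rw [discharge]; rwa [h2] at this ⊢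
    · exact this.trans h2
  · rw [discharge, relabel, if_neg h]
    rcases h2 with h2 | h2
    · rw [h2] at h ⊢; exact .inl ⟨rfl, h⟩
    · exact .inr h2

theorem discharges_spec (hσ : Inv N B R E₀ σ) {k : ℕ} (hk : k ≤ N) :
    Inv N B R E₀ (discharges N B R σ k) ∧
    ((discharges N B R σ k = σ ∧ ∀ u < k, ¬Active N B σ u) ∨
      potential N B R (discharges N B R σ k) < potential N B R σ) := by
  induction k with
  | zero => exact ⟨hσ, .inl ⟨rfl, fun u hu => absurd hu (Nat.not_lt_zero u)⟩⟩
  | succ k ih =>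
    obtain ⟨h1, h2⟩ := ih (by omega)
    obtain ⟨h3, h4⟩ := discharge_spec h1 (show k < N by omega)
    rw [discharges]
    refine ⟨h3, ?_⟩
    rcases h2 with ⟨h2, h5⟩ | h2
    · rw [h2] at h4 ⊢
      refine h4.imp_left fun h4 => ⟨h4.1, fun u hu => ?_⟩
      rcases Nat.lt_succ_iff_lt_or_eq.1 hu with hu | rfl
      exacts [h5 u hu, h4.2]
    · right
      rcases h4 with h4 | h4
      · rw [h4.1]; exact h2
      · exact h4.trans h2

theorem sweeps_spec (hσ : Inv N B R E₀ σ) (k : ℕ) :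
    Inv N B R E₀ (sweeps N B R σ k) ∧
    ((∀ u < N, ¬Active N B (sweeps N B R σ k) u) ∨
      potential N B R (sweeps N B R σ k) + k ≤ potential N B R σ) := by
  induction k with
  | zero => exact ⟨hσ, .inr le_rfl⟩
  | succ k ih =>
    obtain ⟨h1, h2⟩ := ih
    obtain ⟨h3, h4⟩ := discharges_spec h1 le_rfl
    rw [sweeps]
    refine ⟨h3, ?_⟩
    rcases h4 with ⟨h4, h5⟩ | h4
    · rw [h4]; exact .inl h5
    · rcases h2 with h2 | h2
      · have : ∀ j ≤ N, discharges N B R (sweeps N B R σ k) j = sweeps N B R σ k := by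
          intro j
          induction j with
          | zero => exact fun _ => rfl
          | succ j ih =>
            intro hj
            rw [discharges, ih (by omega)]
            have hp : ∀ l, pushes N B R j (sweeps N B R σ k) l = sweeps N B R σ k := by
              intro l
              induction l with
              | zero => rfl
              | succ l ih => rw [pushes, ih, push_eq_self fun h => h2 j (by omega) h.1]
            rw [discharge, hp, relabel, if_neg (h2 j (by omega))]
        rw [this N le_rfl]
        exact .inl h2
      · exact .inr (by omega)

/-- After `liftWeight N * (N * N)` sweeps no node is active. -/
theorem not_active_sweeps (u : ℕ) (hu : u < N) :
    ¬Active N B (sweeps N B R (.init E₀) (liftWeight N * (N * N))) u := by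
  obtain ⟨-, h | h⟩ := sweeps_spec (Inv.init : Inv N B R E₀ _) (liftWeight N * (N * N))
  · exact h u hu
  · intro ha
    rw [potential_init] at h
    have h0 : ∑ x ∈ range N,
        (N - (sweeps N B R (.init E₀) (liftWeight N * (N * N))).H x) = 0 := by
      have : 0 < liftWeight N := by simp [liftWeight]
      by_contra hne
      have : 0 < liftWeight N * ∑ x ∈ range N,
        (N - (sweeps N B R (.init E₀) (liftWeight N * (N * N))).H x) :=
        Nat.mul_pos this (Nat.pos_of_ne_zero hne)
      rw [potential] at h
      omega
    have := sum_eq_zero_iff.1 h0 u (mem_range.2 hu)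
    have := ha.2
    omega

/-- Some height between `0` and `N` does not occur. -/
theorem exists_gap (N : ℕ) (H : ℕ → ℕ) : ∃ k ≤ N, ∀ u < N, H u ≠ k := by
  by_contra! h
  have h1 : range (N + 1) ⊆ (range N).image H := fun k hk => by
    obtain ⟨u, hu, rfl⟩ := h k (by simpa [Nat.lt_succ_iff] using hk)
    exact mem_image_of_mem _ (mem_range.2 hu)
  have h2 := (card_le_card h1).trans card_image_le
  simp at h2

/-! ### The optimality of the closure above a gap -/

theorem Inv.excess (hσ : Inv N B R E₀ σ) {u : ℕ} (hu : u < N) : (E₀ u : ℤ) - B =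
    (σ.E u - B) + (∑ v ∈ range N, (σ.F u v : ℤ) - ∑ v ∈ range N, (σ.F v u : ℤ)) := by
  have := hσ.conservation u hu
  zify at this
  linarith

/-- Flow leaves no closed set, so the weight of a closed set is at most its total excess. -/
theorem Inv.weight_le (hσ : Inv N B R E₀ σ) {C : Finset ℕ} (hC : C ⊆ range N)
    (hR : ∀ u ∈ C, ∀ v < N, R u v → v ∈ C) :
    ∑ u ∈ C, ((E₀ u : ℤ) - B) ≤ ∑ u ∈ C, ((σ.E u : ℤ) - B) := by
  have h1 : ∀ u ∈ C, u < N := fun u hu => mem_range.1 (hC hu)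
  rw [sum_congr rfl fun u hu => hσ.excess (h1 u hu), sum_add_distrib]
  conv_lhs => rw [sum_sub_distrib (s := C) (f := fun u => ∑ v ∈ range N, (σ.F u v : ℤ))]
  have h2 : ∑ u ∈ C, ∑ v ∈ range N, (σ.F u v : ℤ) = ∑ u ∈ C, ∑ v ∈ C, (σ.F u v : ℤ) := by
    refine sum_congr rfl fun u hu => (sum_subset hC fun v hv hvC => ?_).symm
    by_contra hne
    exact hvC (hR u hu v (mem_range.1 hv) (hσ.flow_arc u (h1 u hu) v (mem_range.1 hv)
      (Nat.pos_of_ne_zero (by exact_mod_cast hne))))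
  have h3 : ∑ u ∈ C, ∑ v ∈ C, (σ.F v u : ℤ) ≤ ∑ u ∈ C, ∑ v ∈ range N, (σ.F v u : ℤ) :=
    sum_le_sum fun u _ => sum_le_sum_of_subset_of_nonneg hC fun _ _ _ => by positivity
  have h5 : ∑ u ∈ C, ∑ v ∈ C, (σ.F v u : ℤ) = ∑ u ∈ C, ∑ v ∈ C, (σ.F u v : ℤ) := sum_comm
  linarith

/-- Flow that enters a closed set from below makes a residual arc back down. Hence no flow enters
the set above a gap, and its weight is its total excess. -/
theorem Inv.weight_eq (hσ : Inv N B R E₀ σ) {k : ℕ} (hgap : ∀ u < N, σ.H u ≠ k) :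
    ∑ u ∈ (range N).filter (fun u => k < σ.H u), ((E₀ u : ℤ) - B) =
      ∑ u ∈ (range N).filter (fun u => k < σ.H u), ((σ.E u : ℤ) - B) := by
  set C := (range N).filter fun u => k < σ.H u with hCdef
  have h1 : ∀ u ∈ C, u < N ∧ k < σ.H u := fun u hu => by simpa [hCdef] using hu
  have h4 : ∀ v < N, v ∉ C → σ.H v < k := fun v hv h => by
    have := hgap v hv
    simp only [hCdef, mem_filter, mem_range, hv, true_and, not_lt] at h
    omega
  have hC : C ⊆ range N := filter_subset ..
  rw [sum_congr rfl fun u hu => hσ.excess (h1 u hu).1, sum_add_distrib]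
  conv_lhs => rw [sum_sub_distrib (s := C) (f := fun u => ∑ v ∈ range N, (σ.F u v : ℤ))]
  have h2 : ∑ u ∈ C, ∑ v ∈ range N, (σ.F u v : ℤ) = ∑ u ∈ C, ∑ v ∈ C, (σ.F u v : ℤ) := by
    refine sum_congr rfl fun u hu => (sum_subset hC fun v hv hvC => ?_).symm
    by_contra hne
    have hv := mem_range.1 hv
    have := hσ.height_arc u (h1 u hu).1 v hv (hσ.flow_arc u (h1 u hu).1 v hv
      (Nat.pos_of_ne_zero (by exact_mod_cast hne)))
    have := h4 v hv hvC
    have := (h1 u hu).2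
    omega
  have h3 : ∑ u ∈ C, ∑ v ∈ range N, (σ.F v u : ℤ) = ∑ u ∈ C, ∑ v ∈ C, (σ.F v u : ℤ) := by
    refine sum_congr rfl fun u hu => (sum_subset hC fun v hv hvC => ?_).symm
    by_contra hne
    have hv := mem_range.1 hv
    have := hσ.height_flow u (h1 u hu).1 v hv (Nat.pos_of_ne_zero (by exact_mod_cast hne))
    have := h4 v hv hvC
    have := (h1 u hu).2
    omega
  have h5 : ∑ u ∈ C, ∑ v ∈ C, (σ.F v u : ℤ) = ∑ u ∈ C, ∑ v ∈ C, (σ.F u v : ℤ) := sum_comm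
  linarith

/-- When no node is active, the nodes above a gap form a closed set of maximum weight. -/
theorem Inv.optimal (hσ : Inv N B R E₀ σ) (hact : ∀ u < N, ¬Active N B σ u) {k : ℕ} (hk : k ≤ N)
    (hgap : ∀ u < N, σ.H u ≠ k) :
    (∀ u < N, k < σ.H u → ∀ v < N, R u v → k < σ.H v) ∧
    ∀ C ⊆ range N, (∀ u ∈ C, ∀ v < N, R u v → v ∈ C) → ∑ u ∈ C, ((E₀ u : ℤ) - B) ≤
      ∑ u ∈ (range N).filter (fun u => k < σ.H u), ((E₀ u : ℤ) - B) := by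
  refine ⟨fun u hu hku v hv hR => ?_, fun C hC hR => ?_⟩
  · have := hσ.height_arc u hu v hv hR
    have := hgap v hv
    omega
  · rw [hσ.weight_eq hgap]
    refine (hσ.weight_le hC hR).trans ?_
    rw [sum_filter]
    calc ∑ u ∈ C, ((σ.E u : ℤ) - B)
        ≤ ∑ u ∈ C, if k < σ.H u then (σ.E u : ℤ) - B else 0 := by
          refine sum_le_sum fun u hu => ?_
          have huN := mem_range.1 (hC hu)
          split_ifs with h
          · exact le_rfl
          · have := hact u huN
            have := hgap u huN
            simp only [Active, not_and, not_lt] at *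
            by_contra! h'
            have := this
            have := hact u huN (by omega)
            omega
      _ ≤ _ := by
          refine sum_le_sum_of_subset_of_nonneg hC fun u hu _ => ?_
          have huN := mem_range.1 hu
          split_ifs with h
          · by_contra! h'
            have := hσ.height_neg u huN (by omega)
            omega
          · exact le_rfl

end MaxClosure

/-! ### Envy-free pricings and monotone prices -/

/-- The revenue from an agent with valuation `a` whose cheapest acceptable set has price `x`. -/
noncomputable def gain {α : Type*} [LinearOrder α] [Zero α] (a x : α) : α :=
  if x ≤ a then x else 0

theorem gain_nonneg {a x : ℝ} (hx : 0 ≤ x) : 0 ≤ gain a x := by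
  unfold gain
  split_ifs
  exacts [hx, le_rfl]

namespace SingleMinded

variable {I : SingleMinded}

theorem valuation_nonneg (i : Fin I.m) (S : Finset (Fin I.n)) : 0 ≤ I.valuation i S := by
  unfold valuation
  split_ifs
  exacts [by positivity, le_rfl]

theorem le_maxUtility (v : Fin I.m → Finset (Fin I.n) → ℝ) (p : Finset (Fin I.n) → ℝ) (i : Fin I.m)
    (S : Finset (Fin I.n)) : v i S - p S ≤ maxUtility v p i :=
  Finset.le_sup' (fun S => v i S - p S) (Finset.mem_univ S)

/-- The price of the cheapest set that satisfies the agent `i`. -/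
noncomputable def cheapest (p : Finset (Fin I.n) → ℝ) (i : Fin I.m) : ℝ :=
  (Finset.univ.filter fun S => I.bundle i ⊆ S).inf' ⟨I.bundle i, by simp⟩ p

theorem cheapest_le (p : Finset (Fin I.n) → ℝ) {i : Fin I.m} {S : Finset (Fin I.n)}
    (h : I.bundle i ⊆ S) : cheapest p i ≤ p S :=
  Finset.inf'_le _ (by simpa using h)

theorem le_cheapest {p : Finset (Fin I.n) → ℝ} {i : Fin I.m} {x : ℝ}
    (h : ∀ S, I.bundle i ⊆ S → x ≤ p S) : x ≤ cheapest p i :=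
  Finset.le_inf' _ _ fun S hS => h S (by simpa using hS)

/-- In an envy-free allocation, every winner pays either nothing or the price of the cheapest set
that satisfies her. -/
theorem revenue_le_sum_gain {a : Fin I.m → Finset (Fin I.n)} {p : Finset (Fin I.n) → ℝ}
    (hp : ∀ S, 0 ≤ p S) (h : EnvyFree I.valuation a p) :
    revenue a p ≤ ∑ i, gain (I.value i : ℝ) (cheapest p i) := by
  unfold revenue
  rw [Finset.sum_filter]
  refine Finset.sum_le_sum fun i _ => ?_
  have hc : 0 ≤ cheapest p i := le_cheapest fun S _ => hp S
  split_ifs with hi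
  swap
  · exact gain_nonneg hc
  obtain ⟨h1, h2, h3⟩ := h i
  have hz : 0 ≤ maxUtility I.valuation p i := by
    by_contra! hz
    exact hi (h3 hz)
  have hd : I.valuation i (a i) - p (a i) = maxUtility I.valuation p i := by
    rcases hz.eq_or_lt with hz | hz
    exacts [(h2 hz.symm).resolve_right hi, h1 hz]
  by_cases hb : I.bundle i ⊆ a i
  · have hv : I.valuation i (a i) = I.value i := if_pos hb
    have : cheapest p i = p (a i) := by
      refine le_antisymm (cheapest_le p hb) (le_cheapest fun S hS => ?_)
      have := le_maxUtility I.valuation p i S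
      rw [show I.valuation i S = I.value i from if_pos hS] at this
      linarith
    rw [this, gain, if_pos (by linarith)]
  · have hv : I.valuation i (a i) = 0 := if_neg hb
    have := gain_nonneg (a := (I.value i : ℝ)) hc
    linarith

open Classical in
/-- The pricing that is described by an outcome. -/
noncomputable def Outcome.pricing (o : Outcome I) (S : Finset (Fin I.n)) : ℝ :=
  if S = ∅ then 0 else if h : ∃ i, I.bundle i = S then (o.price h.choose : ℝ) else o.otherPrice

variable {o : Outcome I}

theorem Outcome.pricing_bundle
    (hmono : ∀ i j, I.bundle i ⊆ I.bundle j → o.price i ≤ o.price j) (i : Fin I.m) :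
    o.pricing (I.bundle i) = o.price i := by
  have h : ∃ j, I.bundle j = I.bundle i := ⟨i, rfl⟩
  rw [pricing, if_neg (I.bundle_nonempty i).ne_empty, dif_pos h]
  exact_mod_cast le_antisymm (hmono _ _ h.choose_spec.le) (hmono _ _ h.choose_spec.ge)

theorem Outcome.pricing_of_ne {S : Finset (Fin I.n)} (hS : S ≠ ∅) (h : ∀ i, I.bundle i ≠ S) :
    o.pricing S = o.otherPrice := by
  rw [pricing, if_neg hS, dif_neg (by simpa using h)]

theorem Outcome.describes_pricing
    (hmono : ∀ i j, I.bundle i ⊆ I.bundle j → o.price i ≤ o.price j) : o.Describes o.pricing :=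
  ⟨if_pos rfl, o.pricing_bundle hmono, fun _ => o.pricing_of_ne⟩

theorem Outcome.pricing_nonneg (S : Finset (Fin I.n)) : 0 ≤ o.pricing S := by
  unfold pricing
  split_ifs <;> positivity

/-- If the prices of the bundles are monotone and all other sets are at least as expensive, then
no set that satisfies an agent is cheaper than her bundle. -/
theorem Outcome.price_le_pricing
    (hmono : ∀ i j, I.bundle i ⊆ I.bundle j → o.price i ≤ o.price j)
    (hother : ∀ i, o.price i ≤ o.otherPrice) {i : Fin I.m} {S : Finset (Fin I.n)}
    (h : I.bundle i ⊆ S) : (o.price i : ℝ) ≤ o.pricing S := by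
  by_cases hS : ∃ j, I.bundle j = S
  · obtain ⟨j, rfl⟩ := hS
    rw [o.pricing_bundle hmono]
    exact_mod_cast hmono i j h
  · rw [o.pricing_of_ne ((I.bundle_nonempty i).mono h).ne_empty (by simpa using hS)]
    exact_mod_cast hother i

theorem Outcome.envyFree_pricing
    (hmono : ∀ i j, I.bundle i ⊆ I.bundle j → o.price i ≤ o.price j)
    (hother : ∀ i, o.price i ≤ o.otherPrice)
    (hwin : ∀ i, o.win i = true ↔ o.price i ≤ I.value i) :
    EnvyFree I.valuation o.allocation o.pricing := by
  intro i
  have hz : 0 ≤ maxUtility I.valuation o.pricing i := by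
    have := le_maxUtility I.valuation o.pricing i ∅
    rw [show o.pricing ∅ = 0 from if_pos rfl] at this
    linarith [valuation_nonneg (I := I) i ∅]
  have hle : ∀ S, I.valuation i S - o.pricing S ≤ max ((I.value i : ℝ) - o.price i) 0 := by
    intro S
    by_cases h : I.bundle i ⊆ S
    · rw [show I.valuation i S = I.value i from if_pos h]
      exact le_max_of_le_left (by linarith [o.price_le_pricing hmono hother h])
    · rw [show I.valuation i S = 0 from if_neg h]
      exact le_max_of_le_right (by linarith [o.pricing_nonneg S])
  have hmax : maxUtility I.valuation o.pricing i ≤ max ((I.value i : ℝ) - o.price i) 0 :=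
    Finset.sup'_le _ _ fun S _ => hle S
  by_cases hi : o.win i = true
  · have hpv : (o.price i : ℝ) ≤ I.value i := by exact_mod_cast (hwin i).1 hi
    have hd : o.allocation i ∈ demand I.valuation o.pricing i := by
      rw [max_eq_left (by linarith)] at hmax
      rw [show o.allocation i = I.bundle i from if_pos hi]
      refine le_antisymm (le_maxUtility ..) (hmax.trans (le_of_eq ?_))
      rw [o.pricing_bundle hmono, show I.valuation i (I.bundle i) = I.value i from
        if_pos (Finset.Subset.refl _)]
    exact ⟨fun _ => hd, fun _ => .inl hd, fun h => absurd hz (not_le.2 h)⟩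
  · have hpv : (I.value i : ℝ) < o.price i := by
      rw [hwin, not_le] at hi
      exact_mod_cast hi
    have he : o.allocation i = ∅ := if_neg hi
    rw [max_eq_right (by linarith)] at hmax
    exact ⟨fun h => absurd hmax (not_le.2 h), fun _ => .inr he, fun _ => he⟩

theorem Outcome.revenue_pricing
    (hmono : ∀ i j, I.bundle i ⊆ I.bundle j → o.price i ≤ o.price j)
    (hwin : ∀ i, o.win i = true ↔ o.price i ≤ I.value i) :
    revenue o.allocation o.pricing = ∑ i, gain (I.value i : ℝ) (o.price i) := by
  unfold revenue
  rw [Finset.sum_filter]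
  refine Finset.sum_congr rfl fun i _ => ?_
  by_cases hi : o.win i = true
  · rw [show o.allocation i = I.bundle i from if_pos hi, if_pos (I.bundle_nonempty i).ne_empty,
      o.pricing_bundle hmono, gain, if_pos (by exact_mod_cast (hwin i).1 hi)]
  · have he : o.allocation i = ∅ := if_neg hi
    rw [he, gain, if_neg (by simp), if_neg]
    rw [hwin] at hi
    exact_mod_cast hi

/-- Only the prices of the bundles matter: an outcome with monotone prices is optimal if its
prices maximize the total gain among all monotone prices. -/
theorem Outcome.isRevenueMaximizing_pricing {o : Outcome I}
    (hmono : ∀ i j, I.bundle i ⊆ I.bundle j → o.price i ≤ o.price j)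
    (hother : ∀ i, o.price i ≤ o.otherPrice)
    (hwin : ∀ i, o.win i = true ↔ o.price i ≤ I.value i)
    (hopt : ∀ q : Fin I.m → ℝ, (∀ i, 0 ≤ q i) →
      (∀ i j, I.bundle i ⊆ I.bundle j → q i ≤ q j) →
        ∑ i, gain (I.value i : ℝ) (q i) ≤ ∑ i, gain (I.value i : ℝ) (o.price i)) :
    IsRevenueMaximizing I.valuation o.allocation o.pricing := by
  refine ⟨o.pricing_nonneg, o.envyFree_pricing hmono hother hwin, fun a p hp h => ?_⟩
  rw [o.revenue_pricing hmono hwin]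
  exact (revenue_le_sum_gain hp h).trans (hopt _ (fun i => le_cheapest fun S _ => hp S)
    fun i j hij => le_cheapest fun S hS => cheapest_le p (hij.trans hS))

end SingleMinded

/-! ### Monotone prices as closures -/

namespace MonotonePrices

open Finset

/-- A strict total order on the agents, by valuation `V` and then by index. -/
def key (m : ℕ) (V : ℕ → ℕ) (k : ℕ) : ℕ := V k * m + k

/-- The largest valuation of an agent that comes before `k`, and `0` if there is none. -/
def pred (m : ℕ) (V : ℕ → ℕ) (k : ℕ) : ℕ :=
  ((range m).filter fun j => key m V j < key m V k).sup V

/-- The relation between the nodes of the closure problem. The node `i * m + k` says that the price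
of the bundle of the agent `i` is at least `V k`; the relation says that prices are monotone. -/
def Rel (m : ℕ) (V : ℕ → ℕ) (sub : ℕ → ℕ → Prop) (u v : ℕ) : Prop :=
  sub (u / m) (v / m) ∧ key m V (v % m) ≤ key m V (u % m)

/-- The weight of the node `i * m + k`, shifted by `B`: the change of the gain from the agent `i`
when her price is raised from the level before `V k` to `V k`. -/
noncomputable def shiftedWeight (m B : ℕ) (V : ℕ → ℕ) (u : ℕ) : ℕ :=
  B + gain (V (u / m)) (V (u % m)) - gain (V (u / m)) (pred m V (u % m))

/-- The levels of the agent `i` in a set of nodes. -/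
def levels (m : ℕ) (C : Finset ℕ) (i : ℕ) : Finset ℕ := (range m).filter fun k => i * m + k ∈ C

variable {m B : ℕ} {V : ℕ → ℕ} {sub : ℕ → ℕ → Prop}

theorem le_of_key_le {j k : ℕ} (hj : j < m) (h : key m V k ≤ key m V j) : V k ≤ V j := by
  by_contra! hlt
  have : (V j + 1) * m ≤ V k * m := Nat.mul_le_mul_right m hlt
  rw [add_mul] at this
  unfold key at h
  omega

theorem key_inj {j k : ℕ} (hj : j < m) (hk : k < m) (h : key m V j = key m V k) : j = k := by
  have := le_antisymm (le_of_key_le hk h.le) (le_of_key_le hj h.ge)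
  unfold key at h
  rw [this] at h
  omega

theorem pred_mono {j k : ℕ} (h : key m V j ≤ key m V k) : pred m V j ≤ pred m V k :=
  sup_mono fun i hi => by
    simp only [mem_filter] at hi ⊢
    exact ⟨hi.1, hi.2.trans_le h⟩

theorem le_pred_of_lt {i k : ℕ} (hi : i < m) (h : V i < V k) : V i ≤ pred m V k := by
  refine le_sup (f := V) (mem_filter.2 ⟨mem_range.2 hi, ?_⟩)
  by_contra! h'
  exact absurd (le_of_key_le hi h') (not_le.2 h)

/-- The weights of the levels below a given one telescope. -/
theorem sum_levels (a : ℕ) (D : Finset ℕ) : D ⊆ range m →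
    (∀ k ∈ D, ∀ j < m, key m V j < key m V k → j ∈ D) →
    ∑ k ∈ D, (((gain a (V k) : ℕ) : ℤ) - (gain a (pred m V k) : ℕ)) = (gain a (D.sup V) : ℕ) := by
  induction D using Finset.induction_on_max_value (key m V) with
  | empty => simp [gain]
  | insert k s hk hmax ih =>
    intro hD hdown
    have hkm : k < m := mem_range.1 (hD (mem_insert_self k s))
    have hlt : ∀ x ∈ s, key m V x < key m V k := fun x hx =>
      (hmax x hx).lt_of_ne fun h => hk
        (key_inj (mem_range.1 (hD (mem_insert_of_mem hx))) hkm h ▸ hx)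
    have hs : s = (range m).filter fun j => key m V j < key m V k := by
      ext j
      simp only [mem_filter, mem_range]
      refine ⟨fun hj => ⟨mem_range.1 (hD (mem_insert_of_mem hj)), hlt j hj⟩, fun hj => ?_⟩
      refine (mem_insert.1 (hdown k (mem_insert_self k s) j hj.1 hj.2)).resolve_left ?_
      rintro rfl
      exact lt_irrefl _ hj.2
    have hp : pred m V k = s.sup V := by rw [hs, pred]
    have hsup : (insert k s).sup V = V k := by
      rw [sup_insert]
      exact sup_eq_left.2 (Finset.sup_le fun x hx => le_of_key_le hkm (hmax x hx))
    rw [sum_insert hk, ih (fun x hx => hD (mem_insert_of_mem hx)), hp, hsup]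
    · ring
    · intro x hx j hj hjx
      refine (mem_insert.1 (hdown x (mem_insert_of_mem hx) j hj hjx)).resolve_left ?_
      rintro rfl
      exact absurd (hjx.trans (hlt x hx)) (lt_irrefl _)

theorem sum_range_mul (f : ℕ → ℤ) (a m : ℕ) :
    ∑ u ∈ range (a * m), f u = ∑ i ∈ range a, ∑ k ∈ range m, f (i * m + k) := by
  induction a with
  | zero => simp
  | succ a ih => rw [Nat.succ_mul, sum_range_add, ih, sum_range_succ]

theorem node_div {i k : ℕ} (hk : k < m) : (i * m + k) / m = i := by
  rw [mul_comm, Nat.mul_add_div (by omega), Nat.div_eq_of_lt hk, add_zero]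

theorem node_mod {i k : ℕ} (hk : k < m) : (i * m + k) % m = k := by
  rw [mul_comm, Nat.mul_add_mod, Nat.mod_eq_of_lt hk]

theorem node_lt {i k : ℕ} (hi : i < m) (hk : k < m) : i * m + k < m * m := by
  have : (i + 1) * m ≤ m * m := Nat.mul_le_mul_right m hi
  rw [add_mul] at this
  omega

theorem div_lt {u : ℕ} (hu : u < m * m) : u / m < m := Nat.div_lt_of_lt_mul hu

theorem mod_lt {u : ℕ} (hu : u < m * m) : u % m < m :=
  Nat.mod_lt _ (Nat.pos_of_ne_zero fun h => by simp [h] at hu)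

/-- The weight of a closed set of nodes is the total gain at the prices that it encodes. -/
theorem weight_eq (hrefl : ∀ i < m, sub i i) (hB : ∀ i < m, V i ≤ B) {C : Finset ℕ}
    (hC : C ⊆ range (m * m)) (hR : ∀ u ∈ C, ∀ v < m * m, Rel m V sub u v → v ∈ C) :
    ∑ u ∈ C, ((shiftedWeight m B V u : ℤ) - B) =
      ∑ i ∈ range m, ((gain (V i) ((levels m C i).sup V) : ℕ) : ℤ) := by
  have hfilter : (range (m * m)).filter (· ∈ C) = C := by
    rw [filter_mem_eq_inter, inter_eq_right.2 hC]
  conv_lhs => rw [← hfilter]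
  rw [sum_filter, sum_range_mul]
  refine sum_congr rfl fun i hi => ?_
  have hi := mem_range.1 hi
  rw [← sum_filter, ← sum_levels (m := m)]
  · refine sum_congr rfl fun k hk => ?_
    have hk : k < m := mem_range.1 (mem_filter.1 hk).1
    have h1 : gain (V i) (pred m V k) ≤ B := by
      unfold gain
      split_ifs with h
      exacts [h.trans (hB i hi), Nat.zero_le _]
    rw [shiftedWeight, node_div hk, node_mod hk, Nat.cast_sub (by omega)]
    push_cast
    ring
  · exact filter_subset ..
  · intro k hk j hj hjk
    simp only [levels, mem_filter, mem_range] at hk ⊢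
    refine ⟨hj, hR _ hk.2 _ (node_lt hi hj) ⟨?_, ?_⟩⟩
    · rw [node_div hj, node_div hk.1]; exact hrefl i hi
    · rw [node_mod hj, node_mod hk.1]; exact hjk.le

/-- A closed set encodes monotone prices. -/
theorem sup_levels_mono {C : Finset ℕ} (hR : ∀ u ∈ C, ∀ v < m * m, Rel m V sub u v → v ∈ C)
    {i j : ℕ} (hj : j < m) (h : sub i j) : (levels m C i).sup V ≤ (levels m C j).sup V := by
  refine sup_mono fun k hk => ?_
  simp only [levels, mem_filter, mem_range] at hk ⊢
  refine ⟨hk.1, hR _ hk.2 _ (node_lt hj hk.1) ⟨?_, ?_⟩⟩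
  · rwa [node_div hk.1, node_div hk.1]
  · rw [node_mod hk.1, node_mod hk.1]

/-- A closed set of maximum weight encodes optimal prices. A competing vector of monotone prices
is compared with the closed set that arises when the prices are rounded up to the next valuation
of an agent. -/
theorem sum_gain_le (hrefl : ∀ i < m, sub i i) (hB : ∀ i < m, V i ≤ B) {C : Finset ℕ}
    (hC : C ⊆ range (m * m)) (hR : ∀ u ∈ C, ∀ v < m * m, Rel m V sub u v → v ∈ C)
    (hopt : ∀ C' ⊆ range (m * m), (∀ u ∈ C', ∀ v < m * m, Rel m V sub u v → v ∈ C') →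
      ∑ u ∈ C', ((shiftedWeight m B V u : ℤ) - B) ≤ ∑ u ∈ C, ((shiftedWeight m B V u : ℤ) - B))
    {q : ℕ → ℝ} (hq : ∀ i < m, 0 ≤ q i) (hmono : ∀ i < m, ∀ j < m, sub i j → q i ≤ q j) :
    ∑ i ∈ range m, gain (V i : ℝ) (q i) ≤
      ∑ i ∈ range m, gain (V i : ℝ) ((levels m C i).sup V : ℕ) := by
  classical
  set C' := (range (m * m)).filter fun u => (pred m V (u % m) : ℝ) < q (u / m) with hC'
  have hR' : ∀ u ∈ C', ∀ v < m * m, Rel m V sub u v → v ∈ C' := by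
    intro u hu v hv huv
    simp only [hC', mem_filter, mem_range] at hu ⊢
    have h1 : (pred m V (v % m) : ℝ) ≤ pred m V (u % m) := by exact_mod_cast pred_mono huv.2
    have h2 := hmono _ (div_lt hu.1) _ (div_lt hv) huv.1
    exact ⟨hv, by linarith [hu.2]⟩
  have hle := hopt C' (filter_subset ..) hR'
  rw [weight_eq hrefl hB hC hR, weight_eq hrefl hB (filter_subset ..) hR'] at hle
  have hcast : ∀ a b : ℕ, ((gain a b : ℕ) : ℝ) = gain (a : ℝ) (b : ℝ) := by
    intro a b
    unfold gain
    by_cases h : b ≤ a <;> simp [h]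
  have hle' : ∑ i ∈ range m, gain (V i : ℝ) ((levels m C' i).sup V : ℕ) ≤
      ∑ i ∈ range m, gain (V i : ℝ) ((levels m C i).sup V : ℕ) := by
    simp only [← hcast]
    exact_mod_cast hle
  refine le_trans (sum_le_sum fun i hi => ?_) hle'
  have hi := mem_range.1 hi
  have hmem : ∀ k, k ∈ levels m C' i ↔ k < m ∧ (pred m V k : ℝ) < q i := by
    intro k
    simp only [levels, hC', mem_filter, mem_range]
    constructor
    · rintro ⟨h1, -, h2⟩
      rw [node_div h1, node_mod h1] at h2
      exact ⟨h1, h2⟩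
    · rintro ⟨h1, h2⟩
      rw [node_div h1, node_mod h1]
      exact ⟨h1, node_lt hi h1, h2⟩
  rw [gain]
  split_ifs with hqi
  swap
  · exact gain_nonneg (Nat.cast_nonneg _)
  have h1 : (levels m C' i).sup V ≤ V i := by
    refine Finset.sup_le fun k hk => ?_
    rw [hmem] at hk
    by_contra! hlt
    have : (V i : ℝ) ≤ pred m V k := by exact_mod_cast le_pred_of_lt hi hlt
    linarith [hk.2]
  rw [gain, if_pos (by exact_mod_cast h1)]
  rcases (hq i hi).eq_or_lt with h0 | h0
  · rw [← h0]; positivity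
  -- the first agent, in the order given by `key`, whose valuation reaches `q i`
  obtain ⟨k, hk, hmin⟩ := exists_min_image ((range m).filter fun k => q i ≤ V k) (key m V)
    ⟨i, by simp [hi, hqi]⟩
  simp only [mem_filter, mem_range] at hk hmin
  refine hk.2.trans ?_
  have hkl : k ∈ levels m C' i := by
    refine (hmem k).2 ⟨hk.1, ?_⟩
    by_contra! hge
    obtain ⟨j, hj, hj'⟩ : ∃ j ∈ (range m).filter (fun j => key m V j < key m V k), q i ≤ V j := by
      by_contra! hall
      have : pred m V k < ⌈q i⌉₊ := by
        refine (Finset.sup_lt_iff (by simpa using h0)).2 fun j hj => ?_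
        exact Nat.lt_ceil.2 (hall j hj)
      rw [Nat.lt_ceil] at this
      linarith
    simp only [mem_filter, mem_range] at hj
    exact absurd (hmin j ⟨hj.1, hj'⟩) (not_le.2 hj.2)
  exact_mod_cast le_sup (f := V) hkl

end MonotonePrices

/-! ### The program -/

namespace RAM

namespace Exp

instance : Add Exp := ⟨.op .add⟩
instance : Sub Exp := ⟨.op .sub⟩
instance : Mul Exp := ⟨.op .mul⟩
instance : Div Exp := ⟨.op .div⟩
instance : Mod Exp := ⟨.op .mod⟩
instance (k : ℕ) : OfNat Exp k := ⟨.const k⟩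

/-- The test `a < b`. -/
def less (a b : Exp) : Exp := .op .lt a b

/-- The test `a = b`. -/
def equal (a b : Exp) : Exp := .op .eq a b

variable (s : State) (a b : Exp)

@[simp] theorem value_add : (a + b).value s = a.value s + b.value s := rfl
@[simp] theorem value_sub : (a - b).value s = a.value s - b.value s := rfl
@[simp] theorem value_mul : (a * b).value s = a.value s * b.value s := rfl
@[simp] theorem value_div : (a / b).value s = a.value s / b.value s := rfl
@[simp] theorem value_mod : (a % b).value s = a.value s % b.value s := rfl
@[simp] theorem value_ofNat (k : ℕ) : Exp.value s (no_index (OfNat.ofNat k)) = k := rfl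
@[simp] theorem value_var (x : ℕ) : (var x).value s = s.var x := rfl
@[simp] theorem value_cell (r : ℕ) : (cell r a).value s = s.cell r (a.value s) := rfl
@[simp] theorem value_less :
    (less a b).value s = if a.value s < b.value s then 1 else 0 := rfl
@[simp] theorem value_equal :
    (equal a b).value s = if a.value s = b.value s then 1 else 0 := rfl

end Exp

namespace Cmd

/-- Run the command if the test succeeds. -/
def when (e : Exp) (c : Cmd) : Cmd := ite e c skip

/-- Run the commands one after the other. -/
def block : List Cmd → Cmd
  | [] => skip
  | [c] => c
  | c :: cs => seq c (block cs)

theorem run_block_cons (c d : Cmd) (cs : List Cmd) (s : State) :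
    (block (c :: d :: cs)).run s = (block (d :: cs)).run (c.run s) := rfl

theorem run_block_one (c : Cmd) (s : State) : (block [c]).run s = c.run s := rfl

theorem run_when (e : Exp) (c : Cmd) (s : State) :
    (when e c).run s = if e.value s ≠ 0 then c.run s else s := rfl

theorem run_when_less (a b : Exp) (c : Cmd) (s : State) :
    (when (.less a b) c).run s = if a.value s < b.value s then c.run s else s := by
  simp [run_when]

theorem run_when_equal (a b : Exp) (c : Cmd) (s : State) :
    (when (.equal a b) c).run s = if a.value s = b.value s then c.run s else s := by
  simp [run_when]

theorem run_ite_less (a b : Exp) (c d : Cmd) (s : State) :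
    (ite (.less a b) c d).run s = if a.value s < b.value s then c.run s else d.run s := by
  simp [run_ite]

end Cmd

end RAM

namespace SingleMinded

open RAM RAM.Cmd RAM.Exp

namespace Program

/-- The number of agents. -/
def agents : Exp := cell 0 1

/-- The number of nodes of the closure problem. -/
def nodes : Exp := agents * agents

/-- The position in the input of the block of the agent `i`. -/
def base (i : Exp) : Exp := 2 + i * (cell 0 0 + 2)

/-- The numerator of the valuation of the agent `i`. -/
def num (i : Exp) : Exp := cell 0 (base i + cell 0 0)

/-- The denominator of the valuation of the agent `i`. -/
def den (i : Exp) : Exp := cell 0 (base i + cell 0 0 + 1)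

/-- The item `x` belongs to the bundle of the agent `i`. -/
def has (i x : Exp) : Exp := cell 0 (base i + x)

/-- The common denominator of the valuations, in the variable `2`. -/
def commonDen : Cmd := block [
  assign 2 1,
  forTo 10 agents (assign 2 (var 2 * den (var 10)))]

/-- The valuations over the common denominator, in the array `2`. -/
def values : Cmd :=
  forTo 10 agents (store 2 (var 10) (var 2 / den (var 10) * num (var 10)))

/-- The sort key of an agent. -/
def keyOf (k : Exp) : Exp := cell 2 k * agents + k

/-- The largest valuation before each agent, in the array `3`. -/
def preds : Cmd :=
  forTo 10 agents (block [
    store 3 (var 10) 0,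
    forTo 11 agents (when (less (keyOf (var 11)) (keyOf (var 10)))
      (when (less (cell 3 (var 10)) (cell 2 (var 11)))
        (store 3 (var 10) (cell 2 (var 11)))))])

/-- The inclusions between the bundles, in the array `4`. The bound of the innermost loop is the
number of items, but `0` if there are no agents: in that case the number of items may be
exponential in the length of the input. -/
def inclusions : Cmd :=
  forTo 10 agents (forTo 11 agents (block [
    store 4 (var 10 * agents + var 11) 1,
    forTo 12 (cell 0 0 * less 0 agents) (when (has (var 10) (var 12))
      (when (equal (has (var 11) (var 12)) 0)
        (store 4 (var 10 * agents + var 11) 0)))]))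

/-- The index of the pair `(u, v)` of nodes. -/
def pair (u v : Exp) : Exp := u * agents * agents + v

/-- The relation between the nodes, in the array `5`. -/
def relation : Cmd :=
  forTo 10 nodes (forTo 11 nodes (block [
    store 5 (pair (var 10) (var 11)) 0,
    when (cell 4 (var 10 / agents * agents + var 11 / agents))
      (ite (less (keyOf (var 10 % agents)) (keyOf (var 11 % agents))) skip
        (store 5 (pair (var 10) (var 11)) 1))]))

/-- The sum of the valuations, in the variable `3`. -/
def shift : Cmd := block [
  assign 3 0,
  forTo 10 agents (assign 3 (var 3 + cell 2 (var 10)))]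

/-- The shifted weights of the nodes, in the array `6`. -/
def weights : Cmd :=
  forTo 10 nodes (block [
    store 6 (var 10) (var 3),
    ite (less (cell 2 (var 10 / agents)) (cell 2 (var 10 % agents))) skip
      (store 6 (var 10) (cell 6 (var 10) + cell 2 (var 10 % agents))),
    ite (less (cell 2 (var 10 / agents)) (cell 3 (var 10 % agents))) skip
      (store 6 (var 10) (cell 6 (var 10) - cell 3 (var 10 % agents)))])

/-- Run the command if the node in the variable `14` is active. -/
def whenActive (c : Cmd) : Cmd :=
  when (less (var 3) (cell 6 (var 14))) (when (less (cell 7 (var 14)) nodes) c)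

/-- Move the amount in the variable `6` from the node in the variable `14` to the node in the
variable `15`. -/
def move : Cmd := block [
  store 6 (var 14) (cell 6 (var 14) - var 6),
  store 6 (var 15) (cell 6 (var 15) + var 6)]

/-- Push from the node in the variable `14` to the node in the variable `15`. The arrays `6`, `7`
and `8` hold the contents, the heights and the flow. -/
def push : Cmd :=
  whenActive (when (equal (cell 7 (var 14)) (cell 7 (var 15) + 1))
    (ite (cell 5 (pair (var 14) (var 15)))
      (block [
        assign 6 (cell 6 (var 14) - var 3),
        store 8 (pair (var 14) (var 15)) (cell 8 (pair (var 14) (var 15)) + var 6),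
        move])
      (when (less 0 (cell 8 (pair (var 15) (var 14)))) (block [
        assign 6 (cell 6 (var 14) - var 3),
        when (less (cell 8 (pair (var 15) (var 14))) (var 6))
          (assign 6 (cell 8 (pair (var 15) (var 14)))),
        store 8 (pair (var 15) (var 14)) (cell 8 (pair (var 15) (var 14)) - var 6),
        move]))))

/-- Push out of the node in the variable `14`, and lift it if it is still active. -/
def discharge : Cmd := block [
  forTo 15 nodes push,
  whenActive (store 7 (var 14) (cell 7 (var 14) + 1))]

/-- The number of sweeps. -/
def rounds : Exp := ((nodes + 1) * nodes + 2) * (nodes * nodes)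

/-- The push-relabel method. -/
def sweeps : Cmd := forTo 13 rounds (forTo 14 nodes discharge)

/-- A height that does not occur, in the variable `4`. -/
def gap : Cmd :=
  forTo 10 (nodes + 1) (block [
    assign 5 0,
    forTo 11 nodes (when (equal (cell 7 (var 11)) (var 10)) (assign 5 1)),
    when (equal (var 5) 0) (assign 4 (var 10))])

/-- Start the search for the largest of several valuations. The variables `7`, `8` and `9` hold the
largest valuation that has been seen (over the common denominator), its numerator and its
denominator. -/
def startMax : Cmd := block [assign 7 0, assign 8 0, assign 9 1]

/-- Take the valuation of the agent in the variable `11` into account. -/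
def updateMax : Cmd :=
  when (less (var 7) (cell 2 (var 11))) (block [
    assign 7 (cell 2 (var 11)),
    assign 8 (num (var 11)),
    assign 9 (den (var 11))])

/-- The prices of the bundles and the winners. -/
def prices : Cmd :=
  forTo 10 agents (block [
    startMax,
    forTo 11 agents (when (less (var 4) (cell 7 (var 10 * agents + var 11))) updateMax),
    ite (less (cell 2 (var 10)) (var 7)) (store 1 (2 + var 10 * 3) 0)
      (store 1 (2 + var 10 * 3) 1),
    store 1 (2 + var 10 * 3 + 1) (var 8),
    store 1 (2 + var 10 * 3 + 2) (var 9)])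

/-- The price of all other sets: the largest valuation. -/
def otherPrice : Cmd := block [
  startMax,
  forTo 11 agents updateMax,
  store 1 0 (var 8),
  store 1 1 (var 9),
  assign 1 (2 + agents * 3)]

/-- The algorithm. -/
def main : Cmd := block [commonDen, values, preds, inclusions, relation, shift, weights, sweeps,
  gap, prices, otherPrice]

theorem tame_main : main.Tame := rfl

/-! ### The correctness of the program -/

/-- The number of nodes. -/
def nodesOf (inp : ℕ → ℕ) : ℕ := inp 1 * inp 1

/-- The position of the block of an agent in the input `inp`. -/
def baseOf (inp : ℕ → ℕ) (i : ℕ) : ℕ := 2 + i * (inp 0 + 2)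

/-- The numerator of the valuation of an agent in the input `inp`. -/
def numOf (inp : ℕ → ℕ) (i : ℕ) : ℕ := inp (baseOf inp i + inp 0)

/-- The denominator of the valuation of an agent in the input `inp`. -/
def denOf (inp : ℕ → ℕ) (i : ℕ) : ℕ := inp (baseOf inp i + inp 0 + 1)

variable {inp : ℕ → ℕ} {s : State}

@[simp] theorem value_agents : agents.value s = s.cell 0 1 := rfl
@[simp] theorem value_nodes : nodes.value s = nodesOf (s.cell 0) := rfl
@[simp] theorem value_num (i : Exp) : (num i).value s = numOf (s.cell 0) (i.value s) := rfl
@[simp] theorem value_den (i : Exp) : (den i).value s = denOf (s.cell 0) (i.value s) := rfl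
@[simp] theorem value_has (i x : Exp) :
    (has i x).value s = s.cell 0 (baseOf (s.cell 0) (i.value s) + x.value s) := rfl
@[simp] theorem value_keyOf (k : Exp) :
    (keyOf k).value s = MonotonePrices.key (s.cell 0 1) (s.cell 2) (k.value s) := rfl
@[simp] theorem value_pair (u v : Exp) :
    (pair u v).value s = u.value s * s.cell 0 1 * s.cell 0 1 + v.value s := rfl

open Finset

theorem commonDen_spec (h0 : s.cell 0 = inp) :
    (commonDen.run s).var 2 = ∏ i ∈ range (inp 1), denOf inp i := by
  refine forTo_induction (s := s.setVar 2 1) (b := agents) (x := 10) (n := inp 1) (by simp [h0])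
    (fun k s' => s'.var 2 = ∏ i ∈ range k, denOf inp i) (by simp) ?_
  intro k hk s' hx hv hc hP
  have h0' : s'.cell 0 = inp := (hc 0 rfl).trans h0
  simp [run, hP, h0', hx, prod_range_succ]

theorem values_spec (h0 : s.cell 0 = inp) : ∀ i < inp 1,
    (values.run s).cell 2 i = s.var 2 / denOf inp i * numOf inp i := by
  refine forTo_fill_one (by simp [h0]) 2
    (Q := fun i v => v = s.var 2 / denOf inp i * numOf inp i) fun k hk s' hx hv hc => ?_
  have h0' : s'.cell 0 = inp := (hc 0 rfl).trans h0
  have h2 : s'.var 2 = s.var 2 := hv 2 (by decide) rfl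
  refine ⟨by simp [run_store, hx, h0', h2], fun a ha => by simp [run_store, hx, ha]⟩

theorem preds_spec (h0 : s.cell 0 = inp) : ∀ k < inp 1,
    (preds.run s).cell 3 k = MonotonePrices.pred (inp 1) (s.cell 2) k := by
  refine forTo_fill_one (by simp [h0]) 3
    (Q := fun k v => v = MonotonePrices.pred (inp 1) (s.cell 2) k) fun k hk s' hx hv hc => ?_
  have h0' : s'.cell 0 = inp := (hc 0 rfl).trans h0
  have h2 : s'.cell 2 = s.cell 2 := hc 2 rfl
  simp only [run_block_cons, run_block_one, run_store, value_var, value_ofNat, hx]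
  refine forTo_induction (s := s'.setCell 3 k 0) (b := agents) (x := 11) (n := inp 1)
    (by simp [h0']) (fun l t => t.cell 3 k =
      (((range l).filter fun j => MonotonePrices.key (inp 1) (s.cell 2) j <
        MonotonePrices.key (inp 1) (s.cell 2) k).sup (s.cell 2)) ∧
      ∀ a, a ≠ k → t.cell 3 a = s'.cell 3 a) ?_ ?_
  · refine ⟨by simp, fun a ha => by simp [ha]⟩
  · intro l hl t hxt hvt hct hP
    have h0t : t.cell 0 = inp := (hct 0 rfl).trans h0'
    have h2t : t.cell 2 = s.cell 2 := (hct 2 rfl).trans h2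
    have h10 : t.var 10 = k := (hvt 10 (by decide) rfl).trans hx
    simp only [run_store, run_when_less, value_keyOf, value_var, value_cell, h0t, h2t, h10,
      hxt, range_add_one, filter_insert, hP.1]
    by_cases hkey : MonotonePrices.key (inp 1) (s.cell 2) l <
        MonotonePrices.key (inp 1) (s.cell 2) k
    · simp only [hkey, if_true, sup_insert]
      split_ifs with hlt
      · refine ⟨by simp [hlt.le], fun a ha => by simp [ha, hP.2 a ha]⟩
      · refine ⟨by simp [not_lt.1 hlt, hP.1], hP.2⟩
    · simp only [hkey, if_false]
      exact hP

/-- The bundle of `i` is contained in the bundle of `j`, according to the input `inp`. -/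
def Sub (inp : ℕ → ℕ) (i j : ℕ) : Prop :=
  ∀ x < inp 0, inp (baseOf inp i + x) ≠ 0 → inp (baseOf inp j + x) ≠ 0

theorem inclusions_spec (h0 : s.cell 0 = inp) : ∀ i < inp 1, ∀ j < inp 1,
    ((inclusions.run s).cell 4 (i * inp 1 + j) ≠ 0 ↔ Sub inp i j) := by
  refine forTo_fill_two (by decide) (by simp [h0]) rfl (fun s' h => by simp [h, h0]) rfl 4
    (Q := fun i j v => v ≠ 0 ↔ Sub inp i j) fun i hi j hj s' hx hy hv hc => ?_
  have h0' : s'.cell 0 = inp := (hc 0 rfl).trans h0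
  simp only [run_block_cons, run_block_one, run_store, value_var, value_ofNat, hx, hy, value_add,
    value_mul, value_agents, h0']
  refine forTo_induction (s := s'.setCell 4 (i * inp 1 + j) 1) (x := 12) (n := inp 0)
    (by simp [h0', show 0 < inp 1 by omega])
    (fun x t => (t.cell 4 (i * inp 1 + j) ≠ 0 ↔
      ∀ y < x, inp (baseOf inp i + y) ≠ 0 → inp (baseOf inp j + y) ≠ 0) ∧
      ∀ a, a ≠ i * inp 1 + j → t.cell 4 a = s'.cell 4 a) ?_ ?_
  · refine ⟨by simp, fun a ha => by simp [ha]⟩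
  · intro x hxl t hxt hvt hct hP
    have h0t : t.cell 0 = inp := (hct 0 rfl).trans h0'
    have h10 : t.var 10 = i := (hvt 10 (by decide) rfl).trans hx
    have h11 : t.var 11 = j := (hvt 11 (by decide) rfl).trans hy
    simp only [run_when, value_has, value_var, h0t, h10, hxt,
      Nat.forall_lt_succ_right, ← hP.1]
    by_cases h1 : inp (baseOf inp i + x) = 0
    · simpa [h1] using hP.2
    · by_cases h2 : inp (baseOf inp j + x) = 0
      · simp +contextual [h1, h2, h0t, h10, h11, hxt, run_store, hP.2]
      · simpa [h1, h2, h0t, h11, hxt] using hP.2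

theorem relation_spec (h0 : s.cell 0 = inp)
    (h4 : ∀ i < inp 1, ∀ j < inp 1, (s.cell 4 (i * inp 1 + j) ≠ 0 ↔ Sub inp i j)) :
    ∀ u < nodesOf inp, ∀ v < nodesOf inp, ((relation.run s).cell 5 (u * nodesOf inp + v) ≠ 0 ↔
      MonotonePrices.Rel (inp 1) (s.cell 2) (Sub inp) u v) := by
  refine forTo_fill_two (by decide) (by simp [h0]) rfl (fun s' h => by simp [h, h0]) rfl 5
    (Q := fun u v w => w ≠ 0 ↔ MonotonePrices.Rel (inp 1) (s.cell 2) (Sub inp) u v)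
    fun u hu v hv s' hx hy _ hc => ?_
  have h0' : s'.cell 0 = inp := (hc 0 rfl).trans h0
  have h2' : s'.cell 2 = s.cell 2 := hc 2 rfl
  have h4' : s'.cell 4 = s.cell 4 := hc 4 rfl
  have hidx : u * inp 1 * inp 1 + v = u * nodesOf inp + v := by rw [nodesOf, mul_assoc]
  have hsub := h4 _ (MonotonePrices.div_lt hu) _ (MonotonePrices.div_lt hv)
  simp only [run_block_cons, run_block_one, run_store, run_when, run_ite, run_skip, value_var,
    value_ofNat, hx, hy, value_pair, value_cell, value_add, value_mul, value_div,
    value_agents, h0', h4', hidx, State.setCell_var,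
    State.setCell_cell, MonotonePrices.Rel, ← hsub, ← not_lt]
  by_cases h5 : s.cell 4 (u / inp 1 * inp 1 + v / inp 1) = 0
  · simp +contextual [h5]
  · by_cases h6 : MonotonePrices.key (inp 1) (s.cell 2) (u % inp 1) <
        MonotonePrices.key (inp 1) (s.cell 2) (v % inp 1)
    · simp +contextual [h5, h6, h0', h2', hx, hy]
    · simp +contextual [h5, h6, h0', h2', hx, hy, hidx]

theorem shift_spec (h0 : s.cell 0 = inp) :
    (shift.run s).var 3 = ∑ i ∈ range (inp 1), s.cell 2 i := by
  refine forTo_induction (s := s.setVar 3 0) (b := agents) (x := 10) (n := inp 1) (by simp [h0])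
    (fun k s' => s'.var 3 = ∑ i ∈ range k, s.cell 2 i) (by simp) ?_
  intro k hk s' hx hv hc hP
  have h2' : s'.cell 2 = s.cell 2 := hc 2 rfl
  simp [run_assign, hP, h2', hx, sum_range_succ]

theorem weights_spec (h0 : s.cell 0 = inp)
    (h3 : ∀ k < inp 1, s.cell 3 k = MonotonePrices.pred (inp 1) (s.cell 2) k) :
    ∀ u < nodesOf inp, (weights.run s).cell 6 u =
      MonotonePrices.shiftedWeight (inp 1) (s.var 3) (s.cell 2) u := by
  refine forTo_fill_one (by simp [h0]) 6
    (Q := fun u v => v = MonotonePrices.shiftedWeight (inp 1) (s.var 3) (s.cell 2) u)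
    fun u hu s' hx hv hc => ?_
  have h0' : s'.cell 0 = inp := (hc 0 rfl).trans h0
  have h2' : s'.cell 2 = s.cell 2 := hc 2 rfl
  have h3' : s'.cell 3 = s.cell 3 := hc 3 rfl
  have hB : s'.var 3 = s.var 3 := hv 3 (by decide) rfl
  simp only [run_block_cons, run_block_one, run_store, run_ite_less, run_skip, value_var,
    hx, value_cell, value_add, value_sub, value_div, value_mod, value_agents, hB,
    MonotonePrices.shiftedWeight, gain, ← h3 _ (MonotonePrices.mod_lt hu), ← not_lt]
  by_cases h5 : s.cell 2 (u / inp 1) < s.cell 2 (u % inp 1) <;>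
    by_cases h6 : s.cell 2 (u / inp 1) < s.cell 3 (u % inp 1) <;>
      simp +contextual [h0', h2', h3', hx, h5, h6]

/-- The memory holds the state `σ` of the push-relabel method. -/
structure Holds (inp : ℕ → ℕ) (s : State) (σ : MaxClosure.Preflow) : Prop where
  input : s.cell 0 = inp
  E : s.cell 6 = σ.E
  H : s.cell 7 = σ.H
  F : ∀ a b, b < nodesOf inp → s.cell 8 (a * nodesOf inp + b) = σ.F a b

theorem push_spec {σ : MaxClosure.Preflow} (h : Holds inp s σ) {u v : ℕ} (hu : s.var 14 = u)
    (hv : s.var 15 = v) (huN : u < nodesOf inp) (hvN : v < nodesOf inp) :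
    Holds inp (push.run s) (MaxClosure.push (nodesOf inp) (s.var 3)
      (fun u v => s.cell 5 (u * nodesOf inp + v) ≠ 0) u v σ) := by
  obtain ⟨h0, hE, hH, hF⟩ := h
  have hidx : ∀ u v, u * inp 1 * inp 1 + v = u * nodesOf inp + v := fun u v => by
    rw [nodesOf, mul_assoc]
  unfold MaxClosure.push
  by_cases hact : MaxClosure.Active (nodesOf inp) (s.var 3) σ u
  swap
  · rw [if_neg fun h => hact h.1]
    have : push.run s = s := by
      simp only [push, whenActive, run_when_less, value_var, value_cell, value_nodes, hu, h0, hE,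
        hH]
      split_ifs with h1 h2
      · exact absurd ⟨h1, h2⟩ hact
      · rfl
      · rfl
    rw [this]
    exact ⟨h0, hE, hH, hF⟩
  have h1 := hact.1
  have h2 := hact.2
  have hrow : ∀ a b, b < nodesOf inp → ∀ c d, d < nodesOf inp →
      (a * nodesOf inp + b = c * nodesOf inp + d ↔ a = c ∧ b = d) := fun a b hb c d hd =>
    ⟨row_inj hb hd, by rintro ⟨rfl, rfl⟩; rfl⟩
  by_cases hH' : σ.H u = σ.H v + 1
  swap
  · rw [if_neg fun h => hH' h.2.1]
    have : push.run s = s := by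
      simp [push, whenActive, run_when_less, run_when_equal, hu, hv, h0, hE, hH, hH']
    rw [this]
    exact ⟨h0, hE, hH, hF⟩
  have hne : u ≠ v := by rintro rfl; omega
  rw [hH'] at h2
  by_cases hR : s.cell 5 (u * nodesOf inp + v) = 0
  · by_cases hpos : 0 < σ.F v u
    swap
    · rw [if_neg fun h => h.2.2.elim (fun h => h hR) hpos]
      have : push.run s = s := by
        simp [push, whenActive, run_when_less, run_when_equal, run_ite, hu, hv, h0, hE, hH, hR,
          hidx, hF _ _ huN, hpos]
      rw [this]
      exact ⟨h0, hE, hH, hF⟩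
    rw [if_pos ⟨hact, hH', .inr hpos⟩]
    have hrun : push.run s = move.run ((s.setVar 6 (min (σ.E u - s.var 3) (σ.F v u))).setCell 8
        (v * nodesOf inp + u) (σ.F v u - min (σ.E u - s.var 3) (σ.F v u))) := by
      by_cases hlt : σ.F v u < σ.E u - s.var 3
      · simp [push, whenActive, run_when_less, run_when_equal, run_ite, run_block_cons,
          run_block_one, run_assign, run_store, hu, hv, h0, hE, hH, hR, h1, h2, hH', hidx,
          hF _ _ huN, hpos, hlt, hlt.le]
      · simp [push, whenActive, run_when_less, run_when_equal, run_ite, run_block_cons,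
          run_block_one, run_assign, run_store, hu, hv, h0, hE, hH, hR, h1, h2, hH', hidx,
          hF _ _ huN, hpos, hlt, not_lt.1 hlt]
    rw [hrun]
    constructor
    · simp [move, run_block_cons, run_block_one, run_store, h0]
    · simp [move, run_block_cons, run_block_one, run_store, hu, hv, hE, hne.symm,
        MaxClosure.amount, hR]
    · simp [move, run_block_cons, run_block_one, run_store, hH]
    · intro a b hb
      simp [move, run_block_cons, run_block_one, run_store, MaxClosure.amount, hR,
        Function.update_apply, hrow a b hb v u huN, hF a b hb]
  · rw [if_pos ⟨hact, hH', .inl hR⟩]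
    have hrun : push.run s = move.run ((s.setVar 6 (σ.E u - s.var 3)).setCell 8
        (u * nodesOf inp + v) (σ.F u v + (σ.E u - s.var 3))) := by
      simp [push, whenActive, run_when_less, run_when_equal, run_ite, run_block_cons,
        run_block_one, run_assign, run_store, hu, hv, h0, hE, hH, hR, h1, h2, hH', hidx,
        hF _ _ hvN]
    rw [hrun]
    constructor
    · simp [move, run_block_cons, run_block_one, run_store, h0]
    · simp [move, run_block_cons, run_block_one, run_store, hu, hv, hE, hne.symm,
        MaxClosure.amount, hR]
    · simp [move, run_block_cons, run_block_one, run_store, hH]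
    · intro a b hb
      simp [move, run_block_cons, run_block_one, run_store, MaxClosure.amount, hR,
        Function.update_apply, hrow a b hb u v hvN, hF a b hb]

theorem discharge_spec {σ : MaxClosure.Preflow} (h : Holds inp s σ) {u : ℕ} (hu : s.var 14 = u)
    (huN : u < nodesOf inp) :
    Holds inp (discharge.run s) (MaxClosure.discharge (nodesOf inp) (s.var 3)
      (fun u v => s.cell 5 (u * nodesOf inp + v) ≠ 0) u σ) := by
  set t := (forTo 15 nodes push).run s with ht
  have ht3 : t.var 3 = s.var 3 := run_var rfl s
  have ht14 : t.var 14 = u := (run_var rfl s).trans hu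
  have hpush : Holds inp t (MaxClosure.pushes (nodesOf inp) (s.var 3)
      (fun u v => s.cell 5 (u * nodesOf inp + v) ≠ 0) u σ (nodesOf inp)) := by
    refine forTo_induction (s := s) (n := nodesOf inp) (by simp [h.input])
      (fun k t => Holds inp t (MaxClosure.pushes (nodesOf inp) (s.var 3)
        (fun u v => s.cell 5 (u * nodesOf inp + v) ≠ 0) u σ k)) ⟨h.input, h.E, h.H, h.F⟩ ?_
    intro k hk s' hx hv hc hP
    have := push_spec hP ((hv 14 (by decide) rfl).trans hu) hx huN hk
    rw [hv 3 (by decide) rfl, hc 5 rfl] at this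
    exact ⟨this.input, this.E, this.H, this.F⟩
  rw [MaxClosure.discharge, MaxClosure.relabel]
  set ρ := MaxClosure.pushes (nodesOf inp) (s.var 3)
      (fun u v => s.cell 5 (u * nodesOf inp + v) ≠ 0) u σ (nodesOf inp)
  have hrun : discharge.run s =
      (whenActive (store 7 (var 14) (cell 7 (var 14) + 1))).run t := rfl
  rw [hrun]
  by_cases h1 : s.var 3 < ρ.E u
  · by_cases h2 : ρ.H u < nodesOf inp
    · rw [if_pos ⟨h1, h2⟩]
      have : (whenActive (store 7 (var 14) (cell 7 (var 14) + 1))).run t =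
          t.setCell 7 u (ρ.H u + 1) := by
        simp [whenActive, run_when_less, run_store, ht3, ht14, hpush.input, hpush.E, hpush.H, h1,
          h2]
      rw [this]
      exact ⟨by simp [hpush.input], by simp [hpush.E], by simp [hpush.H], by simpa using hpush.F⟩
    · rw [if_neg fun h => h2 h.2]
      have : (whenActive (store 7 (var 14) (cell 7 (var 14) + 1))).run t = t := by
        simp [whenActive, run_when_less, ht14, hpush.input, hpush.H, h2]
      rwa [this]
  · rw [if_neg fun h => h1 h.1]
    have : (whenActive (store 7 (var 14) (cell 7 (var 14) + 1))).run t = t := by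
      simp [whenActive, run_when_less, ht3, ht14, hpush.E, h1]
    rwa [this]

theorem sweeps_spec {σ : MaxClosure.Preflow} (h : Holds inp s σ) :
    Holds inp (sweeps.run s) (MaxClosure.sweeps (nodesOf inp) (s.var 3)
      (fun u v => s.cell 5 (u * nodesOf inp + v) ≠ 0) σ
      (MaxClosure.liftWeight (nodesOf inp) * (nodesOf inp * nodesOf inp))) := by
  refine forTo_induction (s := s) (by simp [rounds, MaxClosure.liftWeight, h.input])
    (fun k t => Holds inp t (MaxClosure.sweeps (nodesOf inp) (s.var 3)
      (fun u v => s.cell 5 (u * nodesOf inp + v) ≠ 0) σ k)) ⟨h.input, h.E, h.H, h.F⟩ ?_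
  intro k hk s' hx hv hc hP
  have h3 : s'.var 3 = s.var 3 := hv 3 (by decide) rfl
  have h5 : s'.cell 5 = s.cell 5 := hc 5 rfl
  rw [MaxClosure.sweeps]
  set ρ := MaxClosure.sweeps (nodesOf inp) (s.var 3)
      (fun u v => s.cell 5 (u * nodesOf inp + v) ≠ 0) σ k
  have : Holds inp ((forTo 14 nodes discharge).run s') (MaxClosure.discharges (nodesOf inp)
      (s.var 3) (fun u v => s.cell 5 (u * nodesOf inp + v) ≠ 0) ρ (nodesOf inp)) := by
    refine forTo_induction (s := s') (by simp [hP.input])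
      (fun k t => Holds inp t (MaxClosure.discharges (nodesOf inp) (s.var 3)
        (fun u v => s.cell 5 (u * nodesOf inp + v) ≠ 0) ρ k)) ⟨hP.input, hP.E, hP.H, hP.F⟩ ?_
    intro u hu t hxt hvt hct hPt
    have := discharge_spec hPt hxt hu
    rw [hvt 3 (by decide) rfl, hct 5 rfl, h3, h5] at this
    exact ⟨this.input, this.E, this.H, this.F⟩
  exact ⟨this.input, this.E, this.H, this.F⟩

theorem gap_spec (h0 : s.cell 0 = inp) :
    (gap.run s).var 4 ≤ nodesOf inp ∧ ∀ u < nodesOf inp, s.cell 7 u ≠ (gap.run s).var 4 := by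
  have key : (∃ k < nodesOf inp + 1, ∀ u < nodesOf inp, s.cell 7 u ≠ k) →
      (gap.run s).var 4 < nodesOf inp + 1 ∧
        ∀ u < nodesOf inp, s.cell 7 u ≠ (gap.run s).var 4 := by
    refine forTo_induction (s := s) (n := nodesOf inp + 1) (by simp [h0])
      (fun n t => (∃ k < n, ∀ u < nodesOf inp, s.cell 7 u ≠ k) →
        t.var 4 < n ∧ ∀ u < nodesOf inp, s.cell 7 u ≠ t.var 4) (by simp) ?_
    intro k hk s' hx hv hc hP hex
    have h0' : s'.cell 0 = inp := (hc 0 rfl).trans h0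
    have h7' : s'.cell 7 = s.cell 7 := hc 7 rfl
    simp only [run_block_cons, run_block_one, run_assign, run_when_equal, value_ofNat, value_var]
    set t := (forTo 11 nodes (when (equal (cell 7 (var 11)) (var 10)) (assign 5 1))).run
      (s'.setVar 5 0) with ht
    have h10 : t.var 10 = k := (run_var rfl _).trans (by simpa using hx)
    have h4 : t.var 4 = s'.var 4 := (run_var rfl _).trans (by simp)
    have h5 : t.var 5 = 0 ↔ ∀ u < nodesOf inp, s.cell 7 u ≠ k := by
      refine forTo_induction (s := s'.setVar 5 0) (n := nodesOf inp) (by simp [h0'])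
        (fun n t => t.var 5 = 0 ↔ ∀ u < n, s.cell 7 u ≠ k) (by simp) ?_
      intro u hu t hxt hvt hct hPt
      have h7t : t.cell 7 = s.cell 7 := (hct 7 rfl).trans h7'
      have h10t : t.var 10 = k := (hvt 10 (by decide) rfl).trans (by simpa using hx)
      simp only [run_when_equal, run_assign, value_cell, value_var, hxt, h10t, h7t,
        Nat.forall_lt_succ_right, ← hPt]
      by_cases h : s.cell 7 u = k <;> simp [h]
    by_cases h : t.var 5 = 0
    · simpa [h, h10] using h5.1 h
    · obtain ⟨j, hj, hj'⟩ := hex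
      have hjk : j ≠ k := by rintro rfl; exact h (h5.2 hj')
      obtain ⟨h8, h9⟩ := hP ⟨j, by omega, hj'⟩
      simpa [h, h4] using And.intro h8.le h9
  obtain ⟨k, hk, hk'⟩ := MaxClosure.exists_gap (nodesOf inp) (s.cell 7)
  obtain ⟨h1, h2⟩ := key ⟨k, by omega, hk'⟩
  exact ⟨by omega, h2⟩

/-- The numbers `b` and `c` are the numerator and the denominator of a valuation (or of `0`),
and `a` is the same number over the common denominator. -/
def IsValuation (inp V : ℕ → ℕ) (a b c : ℕ) : Prop :=
  (a = 0 ∧ b = 0 ∧ c = 1) ∨ ∃ j < inp 1, a = V j ∧ b = numOf inp j ∧ c = denOf inp j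

/-- The variables `7`, `8` and `9` hold the largest valuation among the agents in `D`. -/
def HoldsMax (inp V : ℕ → ℕ) (s : State) (D : Finset ℕ) : Prop :=
  s.var 7 = D.sup V ∧ IsValuation inp V (s.var 7) (s.var 8) (s.var 9)

theorem startMax_spec (V : ℕ → ℕ) : HoldsMax inp V (startMax.run s) ∅ :=
  ⟨rfl, .inl ⟨rfl, rfl, rfl⟩⟩

theorem updateMax_spec {V : ℕ → ℕ} (h0 : s.cell 0 = inp) (h2 : s.cell 2 = V) {D : Finset ℕ}
    (h : HoldsMax inp V s D) {k : ℕ} (hk : s.var 11 = k) (hkm : k < inp 1) :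
    HoldsMax inp V (updateMax.run s) (insert k D) := by
  obtain ⟨h7, hval⟩ := h
  rw [HoldsMax, sup_insert, ← h7]
  simp only [updateMax, run_when_less, run_block_cons, run_block_one, run_assign, value_var,
    value_cell, hk, h2]
  split_ifs with hlt
  · refine ⟨by simp [hlt.le, hk], .inr ⟨k, hkm, ?_⟩⟩
    simp [hk, h0]
  · exact ⟨(max_eq_right (not_lt.1 hlt)).symm, hval⟩

end Program

end SingleMinded

namespace SingleMinded

open RAM RAM.Cmd RAM.Exp

namespace Program

open Finset

variable {inp : ℕ → ℕ} {s : State}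

/-- The memory cells from `p` on hold a win bit and the fraction that describe the price with the
value `a` over the common denominator, for an agent whose valuation is `v`. -/
def HoldsPrice (inp V : ℕ → ℕ) (c : ℕ → ℕ) (p v a : ℕ) : Prop :=
  c p = (if v < a then 0 else 1) ∧ IsValuation inp V a (c (p + 1)) (c (p + 2))

theorem prices_spec {V : ℕ → ℕ} (h0 : s.cell 0 = inp) (h2 : s.cell 2 = V) :
    ∀ i < inp 1, HoldsPrice inp V ((prices.run s).cell 1) (2 + i * 3) (V i)
      (((range (inp 1)).filter fun k => s.var 4 < s.cell 7 (i * inp 1 + k)).sup V) := by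
  refine forTo_induction (s := s) (n := inp 1) (by simp [h0])
    (fun n t => ∀ i < n, HoldsPrice inp V (t.cell 1) (2 + i * 3) (V i)
      (((range (inp 1)).filter fun k => s.var 4 < s.cell 7 (i * inp 1 + k)).sup V)) (by simp) ?_
  intro i hi s' hx hv hc hP
  have h0' : s'.cell 0 = inp := (hc 0 rfl).trans h0
  have h2' : s'.cell 2 = V := (hc 2 rfl).trans h2
  have h7' : s'.cell 7 = s.cell 7 := hc 7 rfl
  have h4' : s'.var 4 = s.var 4 := hv 4 (by decide) rfl
  simp only [run_block_cons, run_block_one]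
  set t := (forTo 11 agents (when (less (var 4) (cell 7 (var 10 * agents + var 11)))
    updateMax)).run (startMax.run s') with ht
  have t10 : t.var 10 = i := (run_var rfl _).trans ((run_var rfl _).trans hx)
  have t2 : t.cell 2 = V := (run_cell rfl _).trans ((run_cell rfl _).trans h2')
  have t1 : t.cell 1 = s'.cell 1 := (run_cell rfl _).trans (run_cell rfl _)
  have hmax : HoldsMax inp V t
      ((range (inp 1)).filter fun k => s.var 4 < s.cell 7 (i * inp 1 + k)) := by
    refine forTo_induction (s := startMax.run s') (n := inp 1)
      (by rw [value_agents, run_cell rfl, h0'])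
      (fun n t => HoldsMax inp V t
        ((range n).filter fun k => s.var 4 < s.cell 7 (i * inp 1 + k))) ?_ ?_
    · exact startMax_spec (s := s') V
    · intro k hk r hxr hvr hcr hPr
      have r0 : r.cell 0 = inp := (hcr 0 rfl).trans ((run_cell rfl _).trans h0')
      have r2 : r.cell 2 = V := (hcr 2 rfl).trans ((run_cell rfl _).trans h2')
      have r7 : r.cell 7 = s.cell 7 := (hcr 7 rfl).trans ((run_cell rfl _).trans h7')
      have r4 : r.var 4 = s.var 4 :=
        (hvr 4 (by decide) rfl).trans ((run_var rfl _).trans h4')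
      have r10 : r.var 10 = i :=
        (hvr 10 (by decide) rfl).trans ((run_var rfl _).trans hx)
      have := updateMax_spec r0 r2 hPr hxr hk
      simp only [run_when_less, value_var, value_cell, value_add, value_mul, value_agents, r0, r4,
        r7, r10, hxr, range_add_one, filter_insert]
      split_ifs
      · exact this
      · exact hPr
  intro j hj
  simp only [run_ite_less, run_store, value_cell, value_var, t10, t2]
  rcases Nat.lt_succ_iff_lt_or_eq.1 hj with hji | rfl
  · have e0 : 2 + j * 3 ≠ 2 + i * 3 := by omega
    have e1 : 2 + j * 3 ≠ 2 + i * 3 + 1 := by omega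
    have e2 : 2 + j * 3 ≠ 2 + i * 3 + 2 := by omega
    have e3 : 2 + j * 3 + 1 ≠ 2 + i * 3 := by omega
    have e4 : 2 + j * 3 + 1 ≠ 2 + i * 3 + 2 := by omega
    have e5 : 2 + j * 3 + 2 ≠ 2 + i * 3 := by omega
    have e6 : 2 + j * 3 + 2 ≠ 2 + i * 3 + 1 := by omega
    have := hP j hji
    unfold HoldsPrice at this ⊢
    by_cases hlt : V i < t.var 7 <;>
      simpa [hlt, t10, t1, e0, e1, e2, e3, e4, e5, e6, hji.ne] using this
  · unfold HoldsPrice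
    rw [← hmax.1]
    by_cases hlt : V j < t.var 7
    · simpa [hlt, t10] using hmax.2
    · simpa [hlt, t10] using hmax.2

theorem otherPrice_spec {V : ℕ → ℕ} (h0 : s.cell 0 = inp) (h2 : s.cell 2 = V) :
    (otherPrice.run s).var 1 = 2 + inp 1 * 3 ∧
    IsValuation inp V ((range (inp 1)).sup V) ((otherPrice.run s).cell 1 0)
      ((otherPrice.run s).cell 1 1) ∧
    ∀ k, (otherPrice.run s).cell 1 (2 + k) = s.cell 1 (2 + k) := by
  simp only [otherPrice, run_block_cons, run_block_one]
  set t := (forTo 11 agents updateMax).run (startMax.run s) with ht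
  have t0 : t.cell 0 = inp := (run_cell rfl _).trans ((run_cell rfl _).trans h0)
  have t1 : t.cell 1 = s.cell 1 := (run_cell rfl _).trans (run_cell rfl _)
  have hmax : HoldsMax inp V t (range (inp 1)) := by
    refine forTo_induction (s := startMax.run s) (n := inp 1)
      (by rw [value_agents, run_cell rfl, h0]) (fun n t => HoldsMax inp V t (range n)) ?_ ?_
    · exact startMax_spec (s := s) V
    · intro k hk r hxr hvr hcr hPr
      have r0 : r.cell 0 = inp := (hcr 0 rfl).trans ((run_cell rfl _).trans h0)
      have r2 : r.cell 2 = V := (hcr 2 rfl).trans ((run_cell rfl _).trans h2)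
      rw [range_add_one]
      exact updateMax_spec r0 r2 hPr hxr hk
  rw [← hmax.1]
  refine ⟨by simp [run_assign, run_store, t0], ?_, fun k => ?_⟩
  · simpa [run_assign, run_store] using hmax.2
  · have e1 : 2 + k ≠ 1 := by omega
    simp [run_assign, run_store, t1, e1]

/-- The program ends with the encoding of a closed set of maximum weight. -/
theorem main_spec (h0 : s.cell 0 = inp) (h7 : s.cell 7 = fun _ => 0)
    (h8 : s.cell 8 = fun _ => 0) : ∃ (V : ℕ → ℕ) (C : Finset ℕ),
    (∀ i < inp 1, V i = (∏ j ∈ range (inp 1), denOf inp j) / denOf inp i * numOf inp i) ∧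
    C ⊆ range (inp 1 * inp 1) ∧
    (∀ u ∈ C, ∀ v < inp 1 * inp 1, MonotonePrices.Rel (inp 1) V (Sub inp) u v → v ∈ C) ∧
    (∀ C' ⊆ range (inp 1 * inp 1),
      (∀ u ∈ C', ∀ v < inp 1 * inp 1, MonotonePrices.Rel (inp 1) V (Sub inp) u v → v ∈ C') →
      ∑ u ∈ C', ((MonotonePrices.shiftedWeight (inp 1) (∑ i ∈ range (inp 1), V i) V u : ℤ) -
          (∑ i ∈ range (inp 1), V i : ℕ)) ≤
        ∑ u ∈ C, ((MonotonePrices.shiftedWeight (inp 1) (∑ i ∈ range (inp 1), V i) V u : ℤ) -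
          (∑ i ∈ range (inp 1), V i : ℕ))) ∧
    (main.run s).var 1 = 2 + inp 1 * 3 ∧
    IsValuation inp V ((range (inp 1)).sup V) ((main.run s).cell 1 0) ((main.run s).cell 1 1) ∧
    ∀ i < inp 1, HoldsPrice inp V ((main.run s).cell 1) (2 + i * 3) (V i)
      ((MonotonePrices.levels (inp 1) C i).sup V) := by
  obtain ⟨s₁, hs₁⟩ : ∃ t, t = commonDen.run s := ⟨_, rfl⟩
  obtain ⟨s₂, hs₂⟩ : ∃ t, t = values.run s₁ := ⟨_, rfl⟩
  obtain ⟨s₃, hs₃⟩ : ∃ t, t = preds.run s₂ := ⟨_, rfl⟩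
  obtain ⟨s₄, hs₄⟩ : ∃ t, t = inclusions.run s₃ := ⟨_, rfl⟩
  obtain ⟨s₅, hs₅⟩ : ∃ t, t = relation.run s₄ := ⟨_, rfl⟩
  obtain ⟨s₆, hs₆⟩ : ∃ t, t = shift.run s₅ := ⟨_, rfl⟩
  obtain ⟨s₇, hs₇⟩ : ∃ t, t = weights.run s₆ := ⟨_, rfl⟩
  obtain ⟨s₈, hs₈⟩ : ∃ t, t = sweeps.run s₇ := ⟨_, rfl⟩
  obtain ⟨s₉, hs₉⟩ : ∃ t, t = gap.run s₈ := ⟨_, rfl⟩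
  obtain ⟨s₁₀, hs₁₀⟩ : ∃ t, t = prices.run s₉ := ⟨_, rfl⟩
  have hmain : main.run s = otherPrice.run s₁₀ := by
    rw [hs₁₀, hs₉, hs₈, hs₇, hs₆, hs₅, hs₄, hs₃, hs₂, hs₁]
    rfl
  have c1 : s₁.cell 0 = inp := by rw [hs₁, run_cell (c := commonDen) rfl, h0]
  have c2 : s₂.cell 0 = inp := by rw [hs₂, run_cell (c := values) rfl, c1]
  have c3 : s₃.cell 0 = inp := by rw [hs₃, run_cell (c := preds) rfl, c2]
  have c4 : s₄.cell 0 = inp := by rw [hs₄, run_cell (c := inclusions) rfl, c3]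
  have c5 : s₅.cell 0 = inp := by rw [hs₅, run_cell (c := relation) rfl, c4]
  have c6 : s₆.cell 0 = inp := by rw [hs₆, run_cell (c := shift) rfl, c5]
  have c7 : s₇.cell 0 = inp := by rw [hs₇, run_cell (c := weights) rfl, c6]
  have c8 : s₈.cell 0 = inp := by rw [hs₈, run_cell (c := sweeps) rfl, c7]
  have c9 : s₉.cell 0 = inp := by rw [hs₉, run_cell (c := gap) rfl, c8]
  have c10 : s₁₀.cell 0 = inp := by rw [hs₁₀, run_cell (c := prices) rfl, c9]
  obtain ⟨V, hV⟩ : ∃ V, V = s₂.cell 2 := ⟨_, rfl⟩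
  have v3 : s₃.cell 2 = V := by rw [hs₃, run_cell (c := preds) rfl, hV]
  have v4 : s₄.cell 2 = V := by rw [hs₄, run_cell (c := inclusions) rfl, v3]
  have v5 : s₅.cell 2 = V := by rw [hs₅, run_cell (c := relation) rfl, v4]
  have v6 : s₆.cell 2 = V := by rw [hs₆, run_cell (c := shift) rfl, v5]
  have v7 : s₇.cell 2 = V := by rw [hs₇, run_cell (c := weights) rfl, v6]
  have v8 : s₈.cell 2 = V := by rw [hs₈, run_cell (c := sweeps) rfl, v7]
  have v9 : s₉.cell 2 = V := by rw [hs₉, run_cell (c := gap) rfl, v8]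
  have v10 : s₁₀.cell 2 = V := by rw [hs₁₀, run_cell (c := prices) rfl, v9]
  have hpred : ∀ k < inp 1, s₆.cell 3 k = MonotonePrices.pred (inp 1) V k := by
    rw [hs₆, run_cell (c := shift) rfl, hs₅, run_cell (c := relation) rfl, hs₄,
      run_cell (c := inclusions) rfl, hs₃, hV]
    exact preds_spec c2
  have hrel : ∀ u < nodesOf inp, ∀ v < nodesOf inp, (s₇.cell 5 (u * nodesOf inp + v) ≠ 0 ↔
      MonotonePrices.Rel (inp 1) V (Sub inp) u v) := by
    rw [hs₇, run_cell (c := weights) rfl, hs₆, run_cell (c := shift) rfl, hs₅, ← v4]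
    refine relation_spec c4 ?_
    rw [hs₄]
    exact inclusions_spec c3
  have hB6 : s₆.var 3 = ∑ i ∈ range (inp 1), V i := by
    rw [hs₆, ← v5]
    exact shift_spec c5
  have hB : s₇.var 3 = ∑ i ∈ range (inp 1), V i := by
    rw [hs₇, run_var (c := weights) rfl, hB6]
  have hw : ∀ u < nodesOf inp, s₇.cell 6 u =
      MonotonePrices.shiftedWeight (inp 1) (∑ i ∈ range (inp 1), V i) V u := by
    have := weights_spec c6 (by rw [v6]; exact hpred)
    rwa [← hs₇, hB6, v6] at this
  have h7' : s₇.cell 7 = fun _ => 0 := by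
    rw [hs₇, run_cell (c := weights) rfl, hs₆, run_cell (c := shift) rfl, hs₅,
      run_cell (c := relation) rfl, hs₄, run_cell (c := inclusions) rfl, hs₃,
      run_cell (c := preds) rfl, hs₂, run_cell (c := values) rfl, hs₁,
      run_cell (c := commonDen) rfl, h7]
  have h8' : s₇.cell 8 = fun _ => 0 := by
    rw [hs₇, run_cell (c := weights) rfl, hs₆, run_cell (c := shift) rfl, hs₅,
      run_cell (c := relation) rfl, hs₄, run_cell (c := inclusions) rfl, hs₃,
      run_cell (c := preds) rfl, hs₂, run_cell (c := values) rfl, hs₁,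
      run_cell (c := commonDen) rfl, h8]
  have hinit : Holds inp s₇ (.init (s₇.cell 6)) :=
    ⟨c7, rfl, h7', fun a b _ => by rw [h8']; rfl⟩
  have hfinal := sweeps_spec hinit
  rw [← hs₈] at hfinal
  have hgap := gap_spec c8
  rw [← hs₉] at hgap
  set R : ℕ → ℕ → Prop := fun u v => s₇.cell 5 (u * nodesOf inp + v) ≠ 0
  set σ := MaxClosure.sweeps (nodesOf inp) (s₇.var 3) R (.init (s₇.cell 6))
    (MaxClosure.liftWeight (nodesOf inp) * (nodesOf inp * nodesOf inp)) with hσ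
  have hH : s₈.cell 7 = σ.H := hfinal.H
  have hH9 : s₉.cell 7 = σ.H := by rw [hs₉, run_cell (c := gap) rfl, hH]
  rw [hH] at hgap
  have hinv : MaxClosure.Inv (nodesOf inp) (s₇.var 3) R (s₇.cell 6) σ :=
    (MaxClosure.sweeps_spec MaxClosure.Inv.init _).1
  obtain ⟨hclosed, hopt⟩ := hinv.optimal MaxClosure.not_active_sweeps hgap.1 hgap.2
  set C := (range (nodesOf inp)).filter fun u => s₉.var 4 < σ.H u with hC
  have hVal : ∀ i < inp 1,
      V i = (∏ j ∈ range (inp 1), denOf inp j) / denOf inp i * numOf inp i := by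
    rw [hV, hs₂, ← commonDen_spec h0, ← hs₁]
    exact values_spec c1
  obtain ⟨o1, o2, o3⟩ := otherPrice_spec c10 v10
  rw [← hmain] at o1 o2 o3
  refine ⟨V, C, hVal, filter_subset .., ?_, ?_, o1, o2, fun i hi => ?_⟩
  · intro u hu v hv hR
    simp only [hC, mem_filter, mem_range] at hu ⊢
    exact ⟨hv, hclosed u hu.1 hu.2 v hv ((hrel u hu.1 v hv).2 hR)⟩
  · intro C' hC' hR'
    have := hopt C' hC' fun u hu v hv hR =>
      hR' u hu v hv ((hrel u (mem_range.1 (hC' hu)) v hv).1 hR)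
    rw [hB] at this
    have e : ∀ D ⊆ range (nodesOf inp), ∑ u ∈ D, ((s₇.cell 6 u : ℤ) -
        (∑ i ∈ range (inp 1), V i : ℕ)) = ∑ u ∈ D, ((MonotonePrices.shiftedWeight (inp 1)
          (∑ i ∈ range (inp 1), V i) V u : ℤ) - (∑ i ∈ range (inp 1), V i : ℕ)) :=
      fun D hD => sum_congr rfl fun u hu => by rw [hw u (mem_range.1 (hD hu))]
    rwa [e C' hC', e C (filter_subset ..)] at this
  · have hp := prices_spec c9 v9 i hi
    rw [hH9, ← hs₁₀] at hp
    have hl : MonotonePrices.levels (inp 1) C i =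
        (range (inp 1)).filter fun k => s₉.var 4 < σ.H (i * inp 1 + k) := by
      ext k
      simp only [MonotonePrices.levels, hC, mem_filter, mem_range]
      exact ⟨fun h => ⟨h.1, h.2.2⟩, fun h => ⟨h.1, MonotonePrices.node_lt hi h.1, h.2⟩⟩
    rw [hl]
    simpa only [HoldsPrice, add_assoc, o3] using hp

end Program

end SingleMinded

/-! ### Encodings -/

theorem List.getElem?_flatMap_of_length {α β : Type*} {f : α → List β} {L : ℕ} :
    ∀ {l : List α} (_ : ∀ a ∈ l, (f a).length = L) {i : ℕ} {a : α} (_ : l[i]? = some a) {j : ℕ}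
      (_ : j < L), (l.flatMap f)[i * L + j]? = (f a)[j]?
  | [], _, i, a, ha, _, _ => by simp at ha
  | b :: l, hl, 0, a, ha, j, hj => by
    obtain rfl : b = a := by simpa using ha
    rw [List.flatMap_cons, Nat.zero_mul, Nat.zero_add, List.getElem?_append_left]
    rw [hl b List.mem_cons_self]
    exact hj
  | b :: l, hl, i + 1, a, ha, j, hj => by
    have hb := hl b List.mem_cons_self
    rw [List.flatMap_cons, List.getElem?_append_right (by rw [hb, Nat.succ_mul]; omega), hb,
      show (i + 1) * L + j - L = i * L + j by rw [Nat.succ_mul]; omega]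
    exact List.getElem?_flatMap_of_length (fun a h => hl a (List.mem_cons_of_mem b h))
      (by simpa using ha) hj

theorem List.length_flatMap_of_length {α β : Type*} {f : α → List β} {L : ℕ} {l : List α}
    (h : ∀ a ∈ l, (f a).length = L) : (l.flatMap f).length = l.length * L := by
  rw [List.length_flatMap, List.map_congr_left h]
  simp

namespace RAM

theorem size_lt_bitSize_of_mem {a : ℕ} : ∀ {l : List ℕ}, a ∈ l → a.size < bitSize l
  | b :: l, h => by
    have hb : bitSize (b :: l) = b.size + 1 + bitSize l := by simp [bitSize]
    rcases List.mem_cons.1 h with rfl | h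
    · omega
    · have := size_lt_bitSize_of_mem h
      omega

theorem length_le_bitSize : ∀ l : List ℕ, l.length ≤ bitSize l
  | [] => Nat.zero_le _
  | b :: l => by
    have hb : bitSize (b :: l) = b.size + 1 + bitSize l := by simp [bitSize]
    have := length_le_bitSize l
    rw [List.length_cons]
    omega

theorem size_le_self (a : ℕ) : a.size ≤ a := Nat.size_le.2 Nat.lt_two_pow_self

theorem State.bounded_input (l : List ℕ) : (State.input l).Bounded (bitSize l) := by
  refine ⟨fun x => ?_, fun r k => ?_⟩
  · simp only [State.input]
    split_ifs
    · exact (size_le_self _).trans (length_le_bitSize l)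
    · simp
  · simp only [State.input]
    split_ifs
    · rw [List.getD_eq_getElem?_getD]
      by_cases hk : k < l.length
      · rw [List.getElem?_eq_getElem hk]
        exact (size_lt_bitSize_of_mem (List.getElem_mem hk)).le
      · rw [List.getElem?_eq_none (not_lt.1 hk)]
        simp
    · simp

end RAM

namespace SingleMinded

open RAM Program

variable (I : SingleMinded)

/-- The input, as the contents of an array. -/
def inputArray : ℕ → ℕ := fun k => I.encode.getD k 0

theorem inputArray_zero : I.inputArray 0 = I.n := rfl

theorem inputArray_one : I.inputArray 1 = I.m := rfl

theorem inputArray_block (i : Fin I.m) {x : ℕ} (hx : x < I.n + 2) :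
    I.inputArray (baseOf I.inputArray i + x) =
      (((List.finRange I.n).map fun j => if j ∈ I.bundle i then 1 else 0) ++
        [(I.value i).num, (I.value i).den]).getD x 0 := by
  rw [baseOf, inputArray_zero, inputArray, encode, List.getD_eq_getElem?_getD,
    List.getD_eq_getElem?_getD, show 2 + (i : ℕ) * (I.n + 2) + x = (i : ℕ) * (I.n + 2) + x + 1 + 1 by
      omega, List.getElem?_cons_succ, List.getElem?_cons_succ,
    List.getElem?_flatMap_of_length (by simp) (a := i) (by simp) hx]

theorem inputArray_item (i : Fin I.m) (j : Fin I.n) :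
    I.inputArray (baseOf I.inputArray i + j) = if j ∈ I.bundle i then 1 else 0 := by
  rw [inputArray_block I i (by omega), List.getD_eq_getElem?_getD,
    List.getElem?_append_left (by simp)]
  simp

theorem numOf_inputArray (i : Fin I.m) : numOf I.inputArray i = (I.value i).num := by
  rw [numOf, inputArray_zero, inputArray_block I i (by omega), List.getD_eq_getElem?_getD,
    List.getElem?_append_right (by simp)]
  simp

theorem denOf_inputArray (i : Fin I.m) : denOf I.inputArray i = (I.value i).den := by
  rw [denOf, inputArray_zero, add_assoc, inputArray_block I i (by omega),
    List.getD_eq_getElem?_getD, List.getElem?_append_right (by simp)]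
  simp

theorem sub_inputArray (i j : Fin I.m) :
    Sub I.inputArray i j ↔ I.bundle i ⊆ I.bundle j := by
  constructor
  · intro h x hx
    have := h x (by rw [inputArray_zero]; exact x.2)
    rw [inputArray_item, inputArray_item, if_pos hx] at this
    by_contra hxj
    exact this one_ne_zero (if_neg hxj)
  · intro h x hx
    rw [inputArray_zero] at hx
    have h1 := inputArray_item I i ⟨x, hx⟩
    have h2 := inputArray_item I j ⟨x, hx⟩
    dsimp only at h1 h2
    rw [h1, h2]
    by_cases hxi : (⟨x, hx⟩ : Fin I.n) ∈ I.bundle i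
    · simp [h hxi]
    · simp [hxi]

theorem agents_le_bitSize : I.m ≤ bitSize I.encode := by
  refine le_trans ?_ (length_le_bitSize _)
  rw [encode, List.length_cons, List.length_cons,
    List.length_flatMap_of_length (L := I.n + 2) (by simp), List.length_finRange]
  have := Nat.le_mul_of_pos_right I.m (show 0 < I.n + 2 by omega)
  omega

theorem items_le_bitSize (h : 0 < I.m) : I.n ≤ bitSize I.encode := by
  refine le_trans ?_ (length_le_bitSize _)
  rw [encode, List.length_cons, List.length_cons,
    List.length_flatMap_of_length (L := I.n + 2) (by simp), List.length_finRange]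
  have := Nat.le_mul_of_pos_left (I.n + 2) h
  omega

theorem input_cell_zero : (State.input I.encode).cell 0 = I.inputArray := by
  funext k
  simp [State.input, inputArray]

/-- The number of rounds of each loop of the program is polynomial. -/
theorem loopBounds_main : ∀ b ∈ Program.main.loopBounds, b.value (State.input I.encode) ≤
    ((bitSize I.encode * bitSize I.encode + 1) * (bitSize I.encode * bitSize I.encode) + 2) *
      (bitSize I.encode * bitSize I.encode * (bitSize I.encode * bitSize I.encode)) +
      bitSize I.encode * bitSize I.encode + bitSize I.encode + 1 := by
  have hm := I.agents_le_bitSize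
  have hn := I.items_le_bitSize
  set L := bitSize I.encode
  have hmm : I.m * I.m ≤ L * L := Nat.mul_le_mul hm hm
  have h1 : (Program.agents).value (State.input I.encode) ≤ L := by
    rw [value_agents, input_cell_zero]; exact hm
  have h2 : (Program.nodes).value (State.input I.encode) ≤ L * L := by
    rw [value_nodes, input_cell_zero]; exact hmm
  have h3 : (Exp.cell 0 0 * Exp.less 0 agents).value (State.input I.encode) ≤ L := by
    simp only [Exp.value_mul, Exp.value_cell, Exp.value_ofNat, Exp.value_less, value_agents,
      input_cell_zero, inputArray_zero, inputArray_one]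
    split_ifs with h
    · rw [mul_one]; exact hn h
    · simp
  have h4 : (Program.rounds).value (State.input I.encode) ≤
      ((L * L + 1) * (L * L) + 2) * (L * L * (L * L)) :=
    Nat.mul_le_mul (Nat.add_le_add_right (Nat.mul_le_mul (Nat.add_le_add_right h2 1) h2) 2)
      (Nat.mul_le_mul h2 h2)
  have h5 : (Program.nodes + 1).value (State.input I.encode) ≤ L * L + 1 :=
    Nat.add_le_add_right h2 1
  intro b hb
  simp only [Program.main, Cmd.block, Cmd.loopBounds, commonDen, values, preds, inclusions,
    relation, shift, weights, sweeps, discharge, Program.push, whenActive, move, gap, startMax,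
    updateMax, prices, otherPrice, Cmd.when, List.append_nil, List.nil_append,
    List.mem_cons, List.not_mem_nil, or_false, List.cons_append] at hb
  set X := ((L * L + 1) * (L * L) + 2) * (L * L * (L * L))
  rcases hb with rfl | rfl | rfl | rfl | rfl | rfl | rfl | rfl | rfl | rfl | rfl | rfl | rfl |
    rfl | rfl | rfl | rfl | rfl | rfl <;> omega

/-- The bit lengths and the number of steps are polynomial, so the running time is. -/
theorem main_polyTime : ∃ P : Polynomial ℕ, ∀ I : SingleMinded, ∃ t,
    Exec Program.main.compile (State.input I.encode) t (Program.main.run (State.input I.encode)) ∧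
      t ≤ P.eval (bitSize I.encode) := by
  obtain ⟨G, T, h⟩ := Cmd.Tame.runsWithin tame_main
  let K : Polynomial ℕ := ((.X * .X + 1) * (.X * .X) + 2) * (.X * .X * (.X * .X)) +
    .X * .X + .X + 1
  refine ⟨T.comp K * (.X + G.comp K * (.X + 1) + .X + 1), fun I => ?_⟩
  obtain ⟨t, h1, h2, -⟩ := h (State.input I.encode) (bitSize I.encode) (bitSize I.encode)
    (K.eval (bitSize I.encode)) ((State.bounded_input _).2 0) (State.bounded_input _)
    (fun b hb => by simpa [K] using I.loopBounds_main b hb)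
  exact ⟨t, h1, by simpa using h2⟩

/-! ### The outcome that the program computes -/

variable {I}

/-- The product of the denominators of all valuations. -/
def commonDenominator (I : SingleMinded) : ℕ :=
  ∏ j ∈ Finset.range (I.inputArray 1), denOf I.inputArray j

theorem commonDenominator_eq : I.commonDenominator = ∏ i : Fin I.m, (I.value i).den := by
  rw [commonDenominator, inputArray_one, Finset.prod_range]
  exact Finset.prod_congr rfl fun i _ => I.denOf_inputArray i

theorem commonDenominator_pos : 0 < I.commonDenominator := by
  rw [commonDenominator_eq]
  exact Finset.prod_pos fun i _ => (I.value i).den_pos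

theorem value_mul_commonDenominator {V : ℕ → ℕ}
    (hV : ∀ i < I.inputArray 1, V i =
      I.commonDenominator / denOf I.inputArray i * numOf I.inputArray i) (i : Fin I.m) :
    I.value i * I.commonDenominator = V i := by
  rw [hV i (by rw [inputArray_one]; exact i.2), denOf_inputArray, numOf_inputArray]
  have hd : (I.value i).den ∣ I.commonDenominator := by
    rw [commonDenominator_eq]
    exact Finset.dvd_prod_of_mem (fun i => (I.value i).den) (Finset.mem_univ i)
  obtain ⟨c, hc⟩ := hd
  rw [hc, Nat.mul_div_cancel_left _ (I.value i).den_pos]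
  have h0 : ((I.value i).den : ℚ≥0) ≠ 0 := by exact_mod_cast (I.value i).den_pos.ne'
  have h1 : I.value i * (I.value i).den = (I.value i).num := by
    conv_lhs => rw [← NNRat.num_div_den (I.value i)]
    field_simp
    simp
  push_cast
  rw [← mul_assoc, h1, mul_comm]

theorem exists_price {V : ℕ → ℕ} (hV : ∀ i < I.inputArray 1, V i =
      I.commonDenominator / denOf I.inputArray i * numOf I.inputArray i) {a b c : ℕ}
    (h : IsValuation I.inputArray V a b c) :
    ∃ r : ℚ≥0, r.num = b ∧ r.den = c ∧ r * I.commonDenominator = a := by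
  rcases h with ⟨rfl, rfl, rfl⟩ | ⟨j, hj, rfl, rfl, rfl⟩
  · exact ⟨0, by simp⟩
  · rw [inputArray_one] at hj
    exact ⟨I.value ⟨j, hj⟩, (I.numOf_inputArray ⟨j, hj⟩).symm, (I.denOf_inputArray ⟨j, hj⟩).symm,
      value_mul_commonDenominator hV ⟨j, hj⟩⟩

theorem gain_mul {a x d : ℝ} (hd : 0 < d) : gain (a * d) (x * d) = gain a x * d := by
  unfold gain
  simp only [mul_le_mul_iff_left₀ hd]
  split_ifs <;> simp

/-- Prices that come from a closed set of maximum weight are optimal. -/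
theorem Outcome.isRevenueMaximizing_of_closure {o : Outcome I} {V : ℕ → ℕ} {C : Finset ℕ} {B : ℕ}
    (hV : ∀ i < I.inputArray 1, V i =
      I.commonDenominator / denOf I.inputArray i * numOf I.inputArray i)
    (hB : ∀ i < I.m, V i ≤ B) (hC : C ⊆ Finset.range (I.m * I.m))
    (hR : ∀ u ∈ C, ∀ v < I.m * I.m, MonotonePrices.Rel I.m V (Sub I.inputArray) u v → v ∈ C)
    (hopt : ∀ C' ⊆ Finset.range (I.m * I.m),
      (∀ u ∈ C', ∀ v < I.m * I.m, MonotonePrices.Rel I.m V (Sub I.inputArray) u v → v ∈ C') →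
      ∑ u ∈ C', ((MonotonePrices.shiftedWeight I.m B V u : ℤ) - B) ≤
        ∑ u ∈ C, ((MonotonePrices.shiftedWeight I.m B V u : ℤ) - B))
    (hprice : ∀ i : Fin I.m, o.price i * I.commonDenominator =
      ((MonotonePrices.levels I.m C i).sup V : ℕ))
    (hother : o.otherPrice * I.commonDenominator = ((Finset.range I.m).sup V : ℕ))
    (hwin : ∀ i : Fin I.m, o.win i = true ↔ (MonotonePrices.levels I.m C i).sup V ≤ V i) :
    o.Describes o.pricing ∧ IsRevenueMaximizing I.valuation o.allocation o.pricing := by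
  set D := I.commonDenominator with hD
  have hDpos : 0 < (D : ℚ≥0) := by exact_mod_cast commonDenominator_pos
  have hDpos' : 0 < (D : ℝ) := by exact_mod_cast commonDenominator_pos (I := I)
  have hval := fun i => value_mul_commonDenominator hV i
  have cast : ∀ {q : ℚ≥0} {k : ℕ}, q * D = k → (q : ℝ) * D = k :=
    fun h => by exact_mod_cast congrArg (NNRat.cast : ℚ≥0 → ℝ) h
  have hpriceR : ∀ i, (o.price i : ℝ) * D = ((MonotonePrices.levels I.m C i).sup V : ℕ) :=
    fun i => cast (hprice i)
  have hvalR : ∀ i, (I.value i : ℝ) * D = V i :=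
    fun i => cast (hval i)
  have hmono : ∀ i j, I.bundle i ⊆ I.bundle j → o.price i ≤ o.price j := fun i j hij => by
    rw [← mul_le_mul_iff_left₀ hDpos, hprice, hprice]
    exact_mod_cast MonotonePrices.sup_levels_mono hR j.2 ((I.sub_inputArray i j).2 hij)
  refine ⟨o.describes_pricing hmono, o.isRevenueMaximizing_pricing hmono ?_ ?_ ?_⟩
  · intro i
    rw [← mul_le_mul_iff_left₀ hDpos, hprice, hother]
    exact_mod_cast Finset.sup_mono (Finset.filter_subset ..)
  · intro i
    rw [hwin, ← mul_le_mul_iff_left₀ hDpos, hprice, hval]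
    exact_mod_cast Iff.rfl
  · intro q hq hqmono
    -- a competing vector of prices over the common denominator
    let q' : ℕ → ℝ := fun k => if h : k < I.m then q ⟨k, h⟩ * D else 0
    have hq' : ∀ i : Fin I.m, q' i = q i * D := fun i => by simp [q']
    have key := MonotonePrices.sum_gain_le (q := q')
      (fun i hi => (I.sub_inputArray ⟨i, hi⟩ ⟨i, hi⟩).2 (Finset.Subset.refl _)) hB hC hR hopt
      (fun i hi => by
        have := mul_nonneg (hq ⟨i, hi⟩) hDpos'.le
        rwa [← hq' ⟨i, hi⟩] at this)
      (fun i hi j hj hij => by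
        have := mul_le_mul_of_nonneg_right
          (hqmono ⟨i, hi⟩ ⟨j, hj⟩ ((I.sub_inputArray ⟨i, hi⟩ ⟨j, hj⟩).1 hij)) hDpos'.le
        rwa [← hq' ⟨i, hi⟩, ← hq' ⟨j, hj⟩] at this)
    rw [Finset.sum_range, Finset.sum_range] at key
    simp only [hq', ← hvalR, ← hpriceR, gain_mul hDpos', ← Finset.sum_mul] at key
    exact le_of_mul_le_mul_right key hDpos'

theorem Outcome.getElem?_encode (o : Outcome I) (i : Fin I.m) {j : ℕ} (hj : j < 3) :
    (Outcome.encode I o)[2 + i * 3 + j]? =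
      [if o.win i then 1 else 0, (o.price i).num, (o.price i).den][j]? := by
  rw [Outcome.encode, show 2 + (i : ℕ) * 3 + j = (i : ℕ) * 3 + j + 1 + 1 by omega,
    List.getElem?_cons_succ, List.getElem?_cons_succ,
    List.getElem?_flatMap_of_length (by simp) (a := i) (by simp) hj]

theorem Outcome.length_encode (o : Outcome I) : (Outcome.encode I o).length = 2 + I.m * 3 := by
  rw [encode, List.length_cons, List.length_cons,
    List.length_flatMap_of_length (L := 3) (by simp), List.length_finRange]
  omega

theorem Outcome.hasOutput_encode {o : Outcome I} {s : State} (h1 : s.var 1 = 2 + I.m * 3)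
    (hn : s.cell 1 0 = o.otherPrice.num) (hd : s.cell 1 1 = o.otherPrice.den)
    (hwin : ∀ i : Fin I.m, s.cell 1 (2 + i * 3) = if o.win i then 1 else 0)
    (hnum : ∀ i : Fin I.m, s.cell 1 (2 + i * 3 + 1) = (o.price i).num)
    (hden : ∀ i : Fin I.m, s.cell 1 (2 + i * 3 + 2) = (o.price i).den) :
    s.HasOutput (Outcome.encode I o) := by
  refine ⟨by rw [h1, o.length_encode], fun k hk => ?_⟩
  have hk' := hk
  rw [o.length_encode] at hk'
  refine Option.some_injective _ ?_
  rw [← List.getElem?_eq_getElem hk]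
  rcases k with _ | _ | k
  · rw [hn]; rfl
  · rw [hd]; rfl
  · have hi : k / 3 < I.m := by omega
    have e := o.getElem?_encode ⟨k / 3, hi⟩ (j := k % 3) (Nat.mod_lt k (by omega))
    have hkdiv : k + 1 + 1 = 2 + k / 3 * 3 + k % 3 := by omega
    rw [hkdiv, e]
    have h3 : k % 3 < 3 := Nat.mod_lt k (by omega)
    have w := hwin ⟨k / 3, hi⟩
    have n := hnum ⟨k / 3, hi⟩
    have d := hden ⟨k / 3, hi⟩
    dsimp only at w n d
    generalize k % 3 = j at h3
    interval_cases j
    · rw [add_zero, w]; rfl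
    · rw [n]; rfl
    · rw [d]; rfl

/-- The final memory of the program holds the encoding of an optimal outcome. -/
theorem exists_outcome (I : SingleMinded) : ∃ o : Outcome I,
    (Program.main.run (State.input I.encode)).HasOutput (Outcome.encode I o) ∧
      o.Describes o.pricing ∧ IsRevenueMaximizing I.valuation o.allocation o.pricing := by
  obtain ⟨V, C, hV, hC, hR, hopt, h1, hother, hprice⟩ := main_spec I.input_cell_zero
    (by funext k; simp [State.input]) (by funext k; simp [State.input])
  obtain ⟨r, hrn, hrd, hr⟩ := exists_price hV hother
  choose p hpn hpd hp using fun i : Fin I.m => exists_price hV (hprice i i.2).2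
  have hwin := fun i : Fin I.m => (hprice i i.2).1
  let o : Outcome I := ⟨fun i => decide ((MonotonePrices.levels I.m C i).sup V ≤ V i), p, r⟩
  refine ⟨o, Outcome.hasOutput_encode h1 hrn.symm hrd.symm (fun i => ?_) (fun i => (hpn i).symm)
    (fun i => (hpd i).symm), ?_⟩
  · rw [hwin i, inputArray_one]
    simp only [o, decide_eq_true_eq, ← not_lt, ite_not]
  · exact Outcome.isRevenueMaximizing_of_closure hV
      (fun i hi => Finset.single_le_sum (f := V) (fun _ _ => Nat.zero_le _)
        (Finset.mem_range.2 hi)) hC hR hopt hp hr fun i => by simp [o]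

end SingleMinded

/-- For single-minded bidders with unlimited supply, a revenue-maximizing envy-free
allocation/pricing can be computed in polynomial time. -/
theorem theoremp :
    RAM.SolvableInPolyTime SingleMinded.encode SingleMinded.Outcome.encode
      (fun (I : SingleMinded) (o : SingleMinded.Outcome I) =>
        ∃ p : Finset (Fin I.n) → ℝ, o.Describes p ∧
          IsRevenueMaximizing I.valuation o.allocation p) := by
  obtain ⟨P, hP⟩ := SingleMinded.main_polyTime
  refine ⟨SingleMinded.Program.main.compile, P, fun I => ?_⟩
  obtain ⟨t, hexec, ht⟩ := hP I
  obtain ⟨o, hout, hdesc, hopt⟩ := SingleMinded.exists_outcome I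
  exact ⟨t, _, o, hexec, ht, hout, o.pricing, hdesc, hopt⟩
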